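/- Manifolds are smooth, finite-dimensional, without boundary, Hausdorff and second countable. A (hermitean) bundle gerbe with connection $(\mathcal{G},\nabla^{\mathcal{G}})$ on a manifold $M$ consists of a surjective submersion $\pi\colon Y\to M$, a hermitean line bundle with metric connection $(L,\nabla^L)$ on $Y^{[2]}=Y\times_M Y$, a unitary parallel isomorphism $\mu\colon L_{(a,b)}\otimes L_{(b,c)}\to L_{(a,c)}$ over $Y^{[3]}$ that is associative over $Y^{[4]}$, and a curving $B\in\Omega^2(Y,\mathrm{i}\mathbb{R})$ with $\mathrm{curv}(\nabla^L)=p_2^*B-p_1^*B$. Its curvature $H\in\Omega^3(M,\mathrm{i}\mathbb{R})$ is the form with $\pi^*H=\mathrm{d}B$. A section of $(\mathcal{G},\nabla^{\mathcal{G}})$ is a 1-morphism $\mathcal{I}_0\to(\mathcal{G},\nabla^{\mathcal{G}})$ from the trivial bundle gerbe, i.e. a surjective submersion $\zeta\colon Z\to Y$, a hermitean vector bundle $E\to Z$ of finite (locally constant) rank with metric connection, and a unitary parallel isomorphism $\alpha\colon E_{z_2}\to E_{z_1}\otimes L_{(\zeta(z_1),\zeta(z_2))}$ over $Z\times_M Z$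 with $(1\otimes\mu)\circ(\alpha_{12}\otimes 1)\circ\alpha_{23}=\alpha_{13}$ over $Z\times_M Z\times_M Z$. It is zero if $E=0$. **Proposition.** Let $(\mathcal{G},\nabla^{\mathcal{G}})$ be a bundle gerbe with connection on a manifold $M$ with curvature $H$. Then $H$ is closed, and the following hold. 1. Suppose $[H]_{\mathrm{dR}}\neq 0$ in $\mathrm{H}^3_{\mathrm{dR}}(M,\mathrm{i}\mathbb{R})$. Then every section of $(\mathcal{G},\nabla^{\mathcal{G}})$ vanishes over some connected component of $M$. In particular, if $M$ is connected, then $(\mathcal{G},\nabla^{\mathcal{G}})$ admits no non-zero sections. 2. If $M$ is connected and $(\mathcal{G},\nabla^{\mathcal{G}})$ admits a non-zero section, then the Dixmier–Douady class of $\mathcal{G}$ in $\mathrm{H}^3(M,\mathbb{Z})$ is torsion. -/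

import Mathlib

open scoped Manifold ContDiff TensorProduct

universe u

namespace Gerbe

noncomputable section

/-! ### Manifolds -/

/-- A smooth manifold: finite-dimensional, without boundary, Hausdorff, second countable. -/
structure Mfd : Type (u + 1) where
  carrier : Type u
  [top : TopologicalSpace carrier]
  [t2 : T2Space carrier]
  [secondCountable : SecondCountableTopology carrier]
  dim : ℕ
  [charted : ChartedSpace (EuclideanSpace ℝ (Fin dim)) carrier]
  [smooth : IsManifold (𝓡 dim) ∞ carrier]

instance : CoeSort Mfd.{u} (Type u) := ⟨Mfd.carrier⟩

attribute [instance] Mfd.top Mfd.t2 Mfd.secondCountable Mfd.charted Mfd.smooth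

/-- The tangent space `T_x X`. -/
abbrev Tan (X : Mfd.{u}) (x : X) : Type := TangentSpace (𝓡 X.dim) x

/-- Smooth maps between manifolds. -/
abbrev Smooth {X Y : Mfd.{u}} (f : X → Y) : Prop := ContMDiff (𝓡 X.dim) (𝓡 Y.dim) ∞ f

/-- The derivative `T_x X → T_{f x} Y`. -/
abbrev tan {X Y : Mfd.{u}} (f : X → Y) (x : X) : Tan X x →L[ℝ] Tan Y (f x) :=
  mfderiv (𝓡 X.dim) (𝓡 Y.dim) f x

/-- Smooth functions on a subset, with values in a normed space. -/
abbrev SmoothFunOn {X : Mfd.{u}} {V : Type*} [NormedAddCommGroup V] [NormedSpace ℝ V]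
    (f : X → V) (U : Set X) : Prop :=
  ContMDiffOn (𝓡 X.dim) 𝓘(ℝ, V) ∞ f U

/-- The derivative `df_x v` of a complex function along a tangent vector. -/
def derivAlong {X : Mfd.{u}} (f : X → ℂ) (x : X) (v : Tan X x) : ℂ :=
  mfderiv (𝓡 X.dim) 𝓘(ℝ, ℂ) f x v

/-- Surjective submersions. -/
structure IsSurjSubmersion {X Y : Mfd.{u}} (f : X → Y) : Prop where
  submersion : Manifold.IsSubmersion (𝓡 X.dim) (𝓡 Y.dim) ∞ f
  surjective : Function.Surjective f

/-! ### Differential forms and de Rham cohomology -/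

section Forms

variable {V : Type} [NormedAddCommGroup V] [NormedSpace ℝ V]

/-- Not necessarily smooth differential `k`-forms on `X` with values in `V`. -/
def DForm (X : Mfd.{u}) (k : ℕ) (V : Type) [NormedAddCommGroup V] [NormedSpace ℝ V] :
    Type u :=
  ∀ x : X, Tan X x [⋀^Fin k]→L[ℝ] V

instance (X : Mfd.{u}) (k : ℕ) : AddCommGroup (DForm X k V) :=
  inferInstanceAs (AddCommGroup (∀ x : X, Tan X x [⋀^Fin k]→L[ℝ] V))

instance (X : Mfd.{u}) (k : ℕ) : Module ℝ (DForm X k V) :=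
  inferInstanceAs (Module ℝ (∀ x : X, Tan X x [⋀^Fin k]→L[ℝ] V))

namespace DForm

/-- Pullback of a form along a map. -/
def pullback {X Y : Mfd.{u}} {k : ℕ} (f : X → Y) (w : DForm Y k V) : DForm X k V :=
  fun x => (w (f x)).compContinuousLinearMap (tan f x)

/-- The form `w` in the preferred chart at `x₀`: the pullback of `w` along the inverse of the
chart, a form on an open subset (the target of the chart) of Euclidean space. -/
def inChart {X : Mfd.{u}} {k : ℕ} (w : DForm X k V) (x₀ : X) :
    EuclideanSpace ℝ (Fin X.dim) → EuclideanSpace ℝ (Fin X.dim) [⋀^Fin k]→L[ℝ] V :=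
  fun e => (w ((chartAt (EuclideanSpace ℝ (Fin X.dim)) x₀).symm e)).compContinuousLinearMap
    (mfderiv 𝓘(ℝ, EuclideanSpace ℝ (Fin X.dim)) (𝓡 X.dim)
      (chartAt (EuclideanSpace ℝ (Fin X.dim)) x₀).symm e)

/-- Smoothness of a form near every point of a set; used for open sets. -/
def SmoothOn {X : Mfd.{u}} {k : ℕ} (w : DForm X k V) (U : Set X) : Prop :=
  ∀ x ∈ U, ContDiffAt ℝ ∞ (w.inChart x) (chartAt (EuclideanSpace ℝ (Fin X.dim)) x x)

/-- The exterior derivative, computed at `x` in the preferred chart at `x`. -/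
def d {X : Mfd.{u}} {k : ℕ} (w : DForm X k V) : DForm X (k + 1) V :=
  fun x =>
    (extDeriv (w.inChart x)
      (chartAt (EuclideanSpace ℝ (Fin X.dim)) x x)).compContinuousLinearMap
    (mfderiv (𝓡 X.dim) 𝓘(ℝ, EuclideanSpace ℝ (Fin X.dim))
      (chartAt (EuclideanSpace ℝ (Fin X.dim)) x) x)

variable {X : Mfd.{u}} {k : ℕ}

theorem inChart_add (w η : DForm X k V) (x : X) :
    (w + η).inChart x = w.inChart x + η.inChart x := rfl

theorem inChart_smul (c : ℝ) (w : DForm X k V) (x : X) :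
    (c • w).inChart x = c • w.inChart x := rfl

theorem inChart_zero (x : X) : (0 : DForm X k V).inChart x = fun _ => 0 := rfl

theorem SmoothOn.add {w η : DForm X k V} {U : Set X} (h : w.SmoothOn U) (h' : η.SmoothOn U) :
    (w + η).SmoothOn U :=
  fun x hx => (h x hx).add (h' x hx)

theorem SmoothOn.smul (c : ℝ) {w : DForm X k V} {U : Set X} (h : w.SmoothOn U) :
    (c • w).SmoothOn U :=
  fun x hx => (h x hx).const_smul c

theorem SmoothOn.zero (U : Set X) : (0 : DForm X k V).SmoothOn U :=
  fun x _ => by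
    rw [inChart_zero x]
    exact contDiffAt_const

theorem d_add {w η : DForm X k V} (h : w.SmoothOn Set.univ) (h' : η.SmoothOn Set.univ) :
    (w + η).d = w.d + η.d := by
  funext x
  have h1 := (h x trivial).differentiableAt (by simp)
  have h2 := (h' x trivial).differentiableAt (by simp)
  simp only [d, inChart_add, extDeriv_add h1 h2]
  rfl

theorem d_smul (c : ℝ) (w : DForm X k V) : (c • w).d = c • w.d := by
  funext x
  simp only [d, inChart_smul, extDeriv_smul]
  rfl

theorem d_zero : (0 : DForm X k V).d = 0 := by
  simpa using d_smul (0 : ℝ) (0 : DForm X k V)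

end DForm

/-- The space of smooth closed `k`-forms. -/
def closedForms (X : Mfd.{u}) (k : ℕ) (V : Type) [NormedAddCommGroup V] [NormedSpace ℝ V] :
    Submodule ℝ (DForm X k V) where
  carrier := {w | w.SmoothOn Set.univ ∧ w.d = 0}
  add_mem' := fun ha hb => ⟨ha.1.add hb.1, by rw [DForm.d_add ha.1 hb.1, ha.2, hb.2, add_zero]⟩
  zero_mem' := ⟨DForm.SmoothOn.zero _, DForm.d_zero⟩
  smul_mem' := fun c _ ha => ⟨ha.1.smul c, by rw [DForm.d_smul, ha.2, smul_zero]⟩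

/-- The space of exact `(k+1)`-forms: derivatives of smooth `k`-forms. -/
def exactForms (X : Mfd.{u}) (k : ℕ) (V : Type) [NormedAddCommGroup V] [NormedSpace ℝ V] :
    Submodule ℝ (DForm X (k + 1) V) where
  carrier := {w | ∃ η : DForm X k V, η.SmoothOn Set.univ ∧ η.d = w}
  add_mem' := by
    rintro _ _ ⟨a, ha, rfl⟩ ⟨b, hb, rfl⟩
    exact ⟨a + b, ha.add hb, DForm.d_add ha hb⟩
  zero_mem' := ⟨0, DForm.SmoothOn.zero _, DForm.d_zero⟩
  smul_mem' := by
    rintro c _ ⟨a, ha, rfl⟩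
    exact ⟨c • a, ha.smul c, DForm.d_smul c a⟩

/-- The de Rham cohomology `H^{k+1}_dR(X, V)`: closed forms modulo exact forms. -/
abbrev DeRham (X : Mfd.{u}) (k : ℕ) (V : Type) [NormedAddCommGroup V] [NormedSpace ℝ V] :
    Type u :=
  closedForms X (k + 1) V ⧸ (exactForms X k V).submoduleOf (closedForms X (k + 1) V)

/-- The de Rham class of a closed form. -/
def deRhamClass {X : Mfd.{u}} {k : ℕ} (w : closedForms X (k + 1) V) : DeRham X k V :=
  Submodule.Quotient.mk w

end Forms

/-- The real vector space `iℝ` of purely imaginary numbers. -/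
abbrev ImR : Type := skewAdjoint.submodule ℝ ℂ

/-- An `iℝ`-valued form regarded as a complex form. -/
def DForm.toComplex {X : Mfd.{u}} {k : ℕ} (w : DForm X k ImR) : DForm X k ℂ :=
  fun x => (skewAdjoint.submodule ℝ ℂ).subtypeL.compContinuousAlternatingMap (w x)

/-! ### Hermitean vector bundles with connection -/

/-- The data of a complex vector bundle with fibrewise inner product and connection, given by
local frames: over each set `U i` of a cover there are local sections `frame i · a` (`a : κ i`),
and a matrix of 1-forms `conn i`, so that `∇ (frame i · a) = ∑ b, conn i b a ⊗ frame i · b`.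
The conditions on these data are in `IsHermitean`. The values of `frame i` and `conn i`
outside `U i` play no role. -/
structure BundleData (X : Mfd.{u}) where
  fiber : X → Type u
  [normed : ∀ x, NormedAddCommGroup (fiber x)]
  [inner : ∀ x, InnerProductSpace ℂ (fiber x)]
  ι : Type u
  U : ι → Set X
  κ : ι → Type
  [fin : ∀ i, Fintype (κ i)]
  [dec : ∀ i, DecidableEq (κ i)]
  frame : ∀ (i : ι) (x : X), κ i → fiber x
  conn : ∀ i : ι, κ i → κ i → DForm X 1 ℂ

attribute [instance] BundleData.normed BundleData.inner BundleData.fin BundleData.dec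

namespace BundleData

variable {X : Mfd.{u}}

/-- The pullback `f^* E` with the pulled back metric and connection. -/
def pullback {X' : Mfd.{u}} (f : X' → X) (E : BundleData X) : BundleData X' where
  fiber x := E.fiber (f x)
  ι := E.ι
  U i := f ⁻¹' E.U i
  κ := E.κ
  frame i x a := E.frame i (f x) a
  conn i a b := (E.conn i a b).pullback f

/-- The tensor product `E ⊗ F` with the induced metric and connection. -/
def tensor (E F : BundleData X) : BundleData X where
  fiber x := E.fiber x ⊗[ℂ] F.fiber x
  ι := E.ι × F.ι
  U i := E.U i.1 ∩ F.U i.2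
  κ i := E.κ i.1 × F.κ i.2
  frame i x a := E.frame i.1 x a.1 ⊗ₜ[ℂ] F.frame i.2 x a.2
  conn i a b := (if a.2 = b.2 then E.conn i.1 a.1 b.1 else 0) +
    (if a.1 = b.1 then F.conn i.2 a.2 b.2 else 0)

/-- The matrix of a fibrewise linear map in local (orthonormal) frames. -/
def coef (E F : BundleData X) (φ : ∀ x, E.fiber x →ₗ[ℂ] F.fiber x) (i : E.ι) (j : F.ι)
    (b : F.κ j) (a : E.κ i) (x : X) : ℂ :=
  Inner.inner ℂ (F.frame j x b) (φ x (E.frame i x a))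

/-- A fibrewise linear map is smooth if its matrices in local frames are smooth. -/
def IsSmoothMor (E F : BundleData X) (φ : ∀ x, E.fiber x →ₗ[ℂ] F.fiber x) : Prop :=
  ∀ i j b a, SmoothFunOn (coef E F φ i j b a) (E.U i ∩ F.U j)

/-- A fibrewise linear map is parallel if `∇ (φ s) = φ (∇ s)`; in local frames, with `m` the matrix
of `φ`, this reads `dm + A_F m = m A_E`. -/
def IsParallelMor (E F : BundleData X) (φ : ∀ x, E.fiber x →ₗ[ℂ] F.fiber x) : Prop :=
  ∀ i j b a, ∀ x ∈ E.U i ∩ F.U j, ∀ v : Tan X x,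
    derivAlong (coef E F φ i j b a) x v +
      ∑ c, F.conn j b c x ![v] * coef E F φ i j c a x =
    ∑ c, coef E F φ i j b c x * E.conn i c a x ![v]

/-- `E` is a smooth hermitean vector bundle (of finite, locally constant rank) with a metric
connection: the frames are orthonormal frames over the members of an open cover, the connection
1-forms are smooth and skew-hermitean, the changes of frames are smooth, and the connection 1-forms
are related by the gauge transformation law (the identity is smooth and parallel). -/
structure IsHermitean (E : BundleData X) : Prop where
  isOpen : ∀ i, IsOpen (E.U i)
  cover : ∀ x, ∃ i, x ∈ E.U i
  orthonormal : ∀ i, ∀ x ∈ E.U i, Orthonormal ℂ (E.frame i x)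
  span : ∀ i, ∀ x ∈ E.U i, Submodule.span ℂ (Set.range (E.frame i x)) = ⊤
  conn_smooth : ∀ i a b, (E.conn i a b).SmoothOn (E.U i)
  conn_skew : ∀ i a b, ∀ x ∈ E.U i, ∀ v : Tan X x,
    E.conn i a b x ![v] = - star (E.conn i b a x ![v])
  frame_smooth : IsSmoothMor E E fun _ => LinearMap.id
  conn_gauge : IsParallelMor E E fun _ => LinearMap.id

/-- `φ : E → F` is a (smooth, unitary and) parallel isomorphism of hermitean vector bundles with
connection; unitarity is part of the type of `φ`. -/
structure IsUnitaryParallel (E F : BundleData X) (φ : ∀ x, E.fiber x ≃ₗᵢ[ℂ] F.fiber x) :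
    Prop where
  smooth : IsSmoothMor E F fun x => (φ x).toLinearEquiv.toLinearMap
  parallel : IsParallelMor E F fun x => (φ x).toLinearEquiv.toLinearMap

/-- A line bundle `L` with connection has curvature `F`: over the domain of a unitary frame with
connection 1-form `A`, one has `F = dA`. -/
def LineCurvature (L : BundleData X) (F : DForm X 2 ℂ) : Prop :=
  ∀ i a, ∀ x ∈ L.U i, F x = (L.conn i a a).d x

end BundleData

/-! ### Fibre products -/

section Fibre

variable {X M : Mfd.{u}}

/-- The space `X ×_M X`. -/
abbrev Fib2 (π : X → M) : Type u := {p : X × X // π p.1 = π p.2}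

/-- The space `X ×_M X ×_M X`. -/
abbrev Fib3 (π : X → M) : Type u :=
  {p : X × X × X // π p.1 = π p.2.1 ∧ π p.2.1 = π p.2.2}

/-- The smooth structure on `X ×_M X` (for a submersion `X → M`) as an embedded submanifold of
`X × X`. It is uniquely determined: a map to `X ×_M X` is smooth iff its components are. -/
structure FibreSquare (π : X → M) where
  dim : ℕ
  [charted : ChartedSpace (EuclideanSpace ℝ (Fin dim)) (Fib2 π)]
  [smooth : IsManifold (𝓡 dim) ∞ (Fib2 π)]
  smooth_iff : ∀ (T : Mfd.{u}) (h : T → Fib2 π),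
    ContMDiff (𝓡 T.dim) (𝓡 dim) ∞ h ↔
      Smooth (fun t => (h t).1.1) ∧ Smooth (fun t => (h t).1.2)

/-- The smooth structure on `X ×_M X ×_M X` (for a submersion `X → M`) as an embedded submanifold
of `X × X × X`. It is uniquely determined: a map to it is smooth iff its components are. -/
structure FibreCube (π : X → M) where
  dim : ℕ
  [charted : ChartedSpace (EuclideanSpace ℝ (Fin dim)) (Fib3 π)]
  [smooth : IsManifold (𝓡 dim) ∞ (Fib3 π)]
  smooth_iff : ∀ (T : Mfd.{u}) (h : T → Fib3 π),
    ContMDiff (𝓡 T.dim) (𝓡 dim) ∞ h ↔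
      Smooth (fun t => (h t).1.1) ∧ Smooth (fun t => (h t).1.2.1) ∧ Smooth (fun t => (h t).1.2.2)

attribute [instance] FibreSquare.charted FibreSquare.smooth FibreCube.charted FibreCube.smooth

/-- `X ×_M X` as a manifold. -/
abbrev FibreSquare.mfd {π : X → M} (s : FibreSquare π) : Mfd.{u} where
  carrier := Fib2 π
  secondCountable := TopologicalSpace.Subtype.secondCountableTopology _
  dim := s.dim
  charted := s.charted
  smooth := s.smooth

/-- `X ×_M X ×_M X` as a manifold. -/
abbrev FibreCube.mfd {π : X → M} (s : FibreCube π) : Mfd.{u} where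
  carrier := Fib3 π
  secondCountable := TopologicalSpace.Subtype.secondCountableTopology _
  dim := s.dim
  charted := s.charted
  smooth := s.smooth

variable {π : X → M}

/-- The points of `X ×_M X`. -/
abbrev pt2 (a b : X) (h : π a = π b) : Fib2 π := ⟨(a, b), h⟩

/-- The points of `X ×_M X ×_M X`. -/
abbrev pt3 (a b c : X) (h : π a = π b) (h' : π b = π c) : Fib3 π := ⟨(a, b, c), h, h'⟩

/-- `(a, b, c) ↦ (a, b)`. -/
abbrev q12 (t : Fib3 π) : Fib2 π := pt2 t.1.1 t.1.2.1 t.2.1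

/-- `(a, b, c) ↦ (b, c)`. -/
abbrev q23 (t : Fib3 π) : Fib2 π := pt2 t.1.2.1 t.1.2.2 t.2.2

/-- `(a, b, c) ↦ (a, c)`. -/
abbrev q13 (t : Fib3 π) : Fib2 π := pt2 t.1.1 t.1.2.2 (t.2.1.trans t.2.2)

end Fibre

/-! ### Bundle gerbes with connection and their sections -/

/-- A hermitean bundle gerbe with connection on `M`: a surjective submersion `Y → M`, a
hermitean line bundle with connection `L` over `Y ×_M Y`, a unitary parallel isomorphism
`μ : L_{(a,b)} ⊗ L_{(b,c)} → L_{(a,c)}` over `Y ×_M Y ×_M Y` which is associative over the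
fourfold fibre product, and a curving `B ∈ Ω²(Y, iℝ)` with `curv L = p₂^* B - p₁^* B`. -/
structure BundleGerbe (M : Mfd.{u}) where
  Y : Mfd.{u}
  proj : Y → M
  proj_submersion : IsSurjSubmersion proj
  Y2 : FibreSquare proj
  Y3 : FibreCube proj
  L : BundleData Y2.mfd
  hermitean : L.IsHermitean
  line : ∀ p, Module.finrank ℂ (L.fiber p) = 1
  μ : ∀ t : Y3.mfd, ((L.pullback (X' := Y3.mfd) q12).tensor (L.pullback q23)).fiber t ≃ₗᵢ[ℂ]
    (L.pullback (X' := Y3.mfd) q13).fiber t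
  μ_parallel : BundleData.IsUnitaryParallel _ _ μ
  assoc : ∀ (a b c e : Y) (hab : proj a = proj b) (hbc : proj b = proj c) (hce : proj c = proj e)
    (x : L.fiber (pt2 a b hab)) (y : L.fiber (pt2 b c hbc)) (z : L.fiber (pt2 c e hce)),
    μ (pt3 a c e (hab.trans hbc) hce) (μ (pt3 a b c hab hbc) (x ⊗ₜ[ℂ] y) ⊗ₜ[ℂ] z) =
      μ (pt3 a b e hab (hbc.trans hce)) (x ⊗ₜ[ℂ] μ (pt3 b c e hbc hce) (y ⊗ₜ[ℂ] z))
  B : DForm Y 2 ImR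
  B_smooth : B.SmoothOn Set.univ
  B_curv : L.LineCurvature
    (B.pullback (X := Y2.mfd) (fun p => p.1.2) - B.pullback (X := Y2.mfd) (fun p => p.1.1)).toComplex

namespace BundleGerbe

variable {M : Mfd.{u}} (G : BundleGerbe M)

/-- `H` is the curvature 3-form of `G`: the smooth form on `M` with `π^* H = dB`. -/
structure IsCurvature (H : DForm M 3 ImR) : Prop where
  smooth : H.SmoothOn Set.univ
  pullback : H.pullback G.proj = G.B.d

/-- The product `L_{(a,b)} ⊗ L_{(b,c)} → L_{(a,c)}` as a linear map. -/
def mul (a b c : G.Y) (hab : G.proj a = G.proj b) (hbc : G.proj b = G.proj c) :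
    G.L.fiber (pt2 a b hab) ⊗[ℂ] G.L.fiber (pt2 b c hbc) →ₗ[ℂ]
      G.L.fiber (pt2 a c (hab.trans hbc)) :=
  (G.μ (pt3 a b c hab hbc)).toLinearEquiv.toLinearMap

/-- A section of `G`, i.e. a 1-morphism `I_0 → G` from the trivial bundle gerbe `I_0` (given by
the identity of `M`, the trivial line bundle and the curving `0`): a surjective submersion
`Z → Y = M ×_M Y`, a hermitean vector bundle with connection `E` on `Z` (of finite rank), and a
unitary parallel isomorphism `α : E_{z₂} → E_{z₁} ⊗ L_{(ζ z₁, ζ z₂)}` over `Z ×_M Z` compatible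
with the product `μ` over `Z ×_M Z ×_M Z`. -/
structure Section where
  Z : Mfd.{u}
  ζ : Z → G.Y
  ζ_submersion : IsSurjSubmersion ζ
  Z2 : FibreSquare (fun z => G.proj (ζ z))
  E : BundleData Z
  hermitean : E.IsHermitean
  α : ∀ p : Z2.mfd, (E.pullback (X' := Z2.mfd) (fun p => p.1.2)).fiber p ≃ₗᵢ[ℂ]
    ((E.pullback (X' := Z2.mfd) (fun p => p.1.1)).tensor
      (G.L.pullback (X' := Z2.mfd) (fun p => pt2 (ζ p.1.1) (ζ p.1.2) p.2))).fiber p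
  α_parallel : BundleData.IsUnitaryParallel _ _ α
  compat : ∀ (z₁ z₂ z₃ : Z) (h : G.proj (ζ z₁) = G.proj (ζ z₂))
    (h' : G.proj (ζ z₂) = G.proj (ζ z₃)) (e : E.fiber z₃),
    LinearMap.lTensor (E.fiber z₁) (G.mul (ζ z₁) (ζ z₂) (ζ z₃) h h')
      (TensorProduct.assoc ℂ _ _ _
        (LinearMap.rTensor (G.L.fiber (pt2 (ζ z₂) (ζ z₃) h'))
          (α ⟨(z₁, z₂), h⟩).toLinearEquiv.toLinearMap (α ⟨(z₂, z₃), h'⟩ e))) =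
      α ⟨(z₁, z₃), h.trans h'⟩ e

/-- The section vanishes over a subset of `M`: all fibres of `E` over it are zero. -/
def Section.VanishesOver {G : BundleGerbe M} (S : G.Section) (C : Set M) : Prop :=
  ∀ z : S.Z, G.proj (S.ζ z) ∈ C → Subsingleton (S.E.fiber z)

/-- The zero sections: those whose underlying vector bundle is zero. -/
def Section.IsZero {G : BundleGerbe M} (S : G.Section) : Prop :=
  ∀ z : S.Z, Subsingleton (S.E.fiber z)

/-! ### The Dixmier-Douady class -/

/-- An integral Čech 3-cocycle `c` representing the Dixmier-Douady class of `G` on an open cover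
`U`: choose local sections `s i` of `Y → M` over `U i`, unit sections `σ i j` of
`(s i, s j)^* L` over `U i ∩ U j`, and real functions `θ i j k` on `U i ∩ U j ∩ U k` with
`μ (σ i j ⊗ σ j k) = exp (2πi θ i j k) σ i k`; then `c` is the Čech coboundary of `θ`.
(Functions are extended arbitrarily outside the sets on which they matter; in particular
`s i` is a section everywhere, but is smooth only over `U i`.) -/
structure DDCocycle where
  ι : Type u
  U : ι → Set M
  isOpen : ∀ i, IsOpen (U i)
  cover : ∀ x, ∃ i, x ∈ U i
  s : ι → M → G.Y
  proj_s : ∀ i x, G.proj (s i x) = x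
  s_smooth : ∀ i, ContMDiffOn (𝓡 M.dim) (𝓡 G.Y.dim) ∞ (s i) (U i)
  σ : ∀ i j x, G.L.fiber (pt2 (s i x) (s j x) ((proj_s i x).trans (proj_s j x).symm))
  σ_unit : ∀ i j, ∀ x ∈ U i ∩ U j, ‖σ i j x‖ = 1
  σ_smooth : ∀ i j k a,
    SmoothFunOn (fun x => Inner.inner ℂ (G.L.frame k (pt2 (s i x) (s j x) _) a) (σ i j x))
      {x | x ∈ U i ∩ U j ∧ pt2 (s i x) (s j x) ((proj_s i x).trans (proj_s j x).symm) ∈ G.L.U k}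
  θ : ι → ι → ι → M → ℝ
  θ_smooth : ∀ i j k, SmoothFunOn (θ i j k) (U i ∩ U j ∩ U k)
  mul_σ : ∀ i j k, ∀ x ∈ U i ∩ U j ∩ U k,
    G.mul (s i x) (s j x) (s k x) ((proj_s i x).trans (proj_s j x).symm)
      ((proj_s j x).trans (proj_s k x).symm) (σ i j x ⊗ₜ[ℂ] σ j k x) =
    Complex.exp (2 * Real.pi * Complex.I * (θ i j k x : ℂ)) • σ i k x
  c : ι → ι → ι → ι → M → ℤ
  c_eq : ∀ i j k l, ∀ x ∈ U i ∩ U j ∩ U k ∩ U l,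
    (c i j k l x : ℝ) = θ j k l x - θ i k l x + θ i j l x - θ i j k x

/-- The Dixmier-Douady class of `G` in the Čech cohomology group
`H³(M, ℤ) = colim_U H³(U, ℤ)` is torsion: for some `n ≥ 1`, on some open cover `n` times
a representing cocycle is the coboundary of a cochain of locally constant integral functions. -/
def DDTorsion : Prop :=
  ∃ n : ℕ, 1 ≤ n ∧ ∃ (D : G.DDCocycle) (b : D.ι → D.ι → D.ι → M → ℤ),
    (∀ i j k, ContinuousOn (b i j k) (D.U i ∩ D.U j ∩ D.U k)) ∧
    ∀ i j k l, ∀ x ∈ D.U i ∩ D.U j ∩ D.U k ∩ D.U l,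
      (n : ℤ) * D.c i j k l x = b j k l x - b i k l x + b i j l x - b i j k x

end BundleGerbe

end

end Gerbe

/-!
The curvature `H` is closed because it is locally exact: for a local section `s` of `π : Y → M`,
the relation `π^* H = dB` gives `H = d (s^* B)`.

Let `(E, α)` be a section over `ζ : Z → Y`. As `L` has rank one, `α` shows that the rank of `E` is
the same at all points of a fibre of `Z → M`, so it descends to a locally constant function
`Section.rank` on `M`, and a section whose rank vanishes at a point vanishes over the component of
that point.

*The class of `H`.* If `m` is the matrix of `α` in local frames, `α` being parallel gives
`tr A (z₂) = tr A (z₁) + r A_L + tr (m⁻¹ dm)` for the connection forms. The form `tr (m⁻¹ dm)` is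
closed for unitary `m` (`extDeriv_traceForm`), so that `tr F_E (z₂) - tr F_E (z₁)` is `r` times
`curv L`, that is, `r` times the difference of the curvings
(`BundleGerbe.Section.LocalTriv.extDeriv_trConn_eq`). Where `r ≠ 0`, the pullback of
`r⁻¹ tr F_E - ζ^* B` along a local section of `Z → M` is therefore independent of the local section.
If the rank vanishes nowhere these forms glue to a global form with exterior derivative `-H`, and
`H` is exact (`BundleGerbe.Section.mem_exactForms_of_rank_ne_zero`). The real part of `tr F_E` is
discarded by projecting to `iℝ`, which avoids showing that it is zero.

*The Dixmier-Douady class.* A non-zero section over a connected base has constant rank `r ≥ 1`. Over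
the members of a fine enough open cover choose local sections of `Z → M` and orthonormal frames of
`E`, and over double intersections unit sections of `L`, in which the product `μ` has structure
functions `g` with values in `U(1)`. Compatibility of `α` with `μ` reads
`N_ac = g_abc N_ab N_bc` for the matrices `N` of `α` (`TrivCover.N_mul`), and its determinant
exhibits `g ^ r` as a coboundary. After taking logarithms, `r` times the integral cocycle defined by
`g` is the coboundary of an integral cochain (`TrivCover.ddTorsion`). A good cover is not needed:
paracompactness gives covers over which the finitely many local choices at each point are possible
on all non-empty intersections (`exists_refinement`).
-/

open scoped Topology

namespace Gerbe

noncomputable section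

/-! ### Local sections of submersions and maps into fibre products -/

section LocalSections

variable {X Y : Mfd.{u}}

/-- A submersion has a smooth local section through every point of its domain: in suitable charts
the submersion is a linear projection, which is split. -/
theorem IsSurjSubmersion.exists_localSection {f : X → Y} (hf : IsSurjSubmersion f) (x : X) :
    ∃ (U : Set Y) (s : Y → X), IsOpen U ∧ f x ∈ U ∧
      ContMDiffOn (𝓡 Y.dim) (𝓡 X.dim) ∞ s U ∧ s (f x) = x ∧ ∀ y ∈ U, f (s y) = y := by
  obtain ⟨F, _, _, hF⟩ := hf.submersion
  obtain ⟨⟨φ, ψ, hx, hfx, hφ, hψ, hsub, e, he⟩⟩ := hF x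
  let P : EuclideanSpace ℝ (Fin Y.dim) → EuclideanSpace ℝ (Fin X.dim) :=
    fun w => e.symm (w, (e (φ x)).2)
  have hP : ContDiff ℝ ∞ P := by fun_prop
  have he' : ∀ z ∈ φ.target, ψ (f (φ.symm z)) = (e z).1 := fun z hz => by
    have := he (x := z) (by simpa using hz)
    simpa using this
  have hPx : P (ψ (f x)) = φ x := by
    have := he' (φ x) (φ.map_source hx)
    rw [φ.left_inv hx] at this
    simp [P, this]
  let U : Set Y := ψ.source ∩ ψ ⁻¹' (P ⁻¹' φ.target)
  have hUo : IsOpen U := ψ.isOpen_inter_preimage (φ.open_target.preimage hP.continuous)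
  refine ⟨U, fun y => φ.symm (P (ψ y)), hUo, ⟨hfx, ?_⟩, ?_, ?_, ?_⟩
  · change P (ψ (f x)) ∈ φ.target
    rw [hPx]
    exact φ.map_source hx
  · have h1 : ContMDiffOn (𝓡 Y.dim) (𝓡 Y.dim) ∞ ψ U :=
      (contMDiffOn_of_mem_maximalAtlas hψ).mono fun y hy => hy.1
    have h2 := contMDiffOn_symm_of_mem_maximalAtlas hφ
    exact h2.comp (hP.contMDiff.comp_contMDiffOn h1) fun y hy => hy.2
  · change φ.symm (P (ψ (f x))) = x
    rw [hPx, φ.left_inv hx]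
  · intro y hy
    have h1 := he' (P (ψ y)) hy.2
    have h2 : f (φ.symm (P (ψ y))) ∈ ψ.source := hsub (φ.map_target hy.2)
    refine ψ.injOn h2 hy.1 ?_
    rw [h1]
    simp [P]

theorem IsSurjSubmersion.smooth {f : X → Y} (hf : IsSurjSubmersion f) : Smooth f :=
  hf.submersion.contMDiff

end LocalSections

section FibreProducts

variable {X M : Mfd.{u}} {π : X → M}

/-- An open subset of a manifold as a manifold. -/
abbrev Mfd.opens (T : Mfd.{u}) (U : TopologicalSpace.Opens T) : Mfd.{u} where
  carrier := U
  dim := T.dim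

/-- A continuous map into the fibre square with smooth components on an open set is smooth there. -/
theorem FibreSquare.contMDiffOn (s : FibreSquare π) {T : Mfd.{u}} {U : Set T} (hU : IsOpen U)
    (h : T → Fib2 π)
    (h1 : ContMDiffOn (𝓡 T.dim) (𝓡 X.dim) ∞ (fun t => (h t).1.1) U)
    (h2 : ContMDiffOn (𝓡 T.dim) (𝓡 X.dim) ∞ (fun t => (h t).1.2) U) :
    ContMDiffOn (𝓡 T.dim) (𝓡 s.mfd.dim) ∞ (fun t => (h t : s.mfd)) U := by
  let U' : TopologicalSpace.Opens T := ⟨U, hU⟩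
  have key := (s.smooth_iff (T.opens U') fun t => h t.1).2
    ⟨fun t => (contMDiffAt_subtype_iff (I := 𝓡 T.dim)).2 (h1.contMDiffAt (hU.mem_nhds t.2)),
      fun t => (contMDiffAt_subtype_iff (I := 𝓡 T.dim)).2 (h2.contMDiffAt (hU.mem_nhds t.2))⟩
  exact fun t ht => ((contMDiffAt_subtype_iff (I := 𝓡 T.dim)).1 (key ⟨t, ht⟩)).contMDiffWithinAt

theorem FibreCube.contMDiffOn (s : FibreCube π) {T : Mfd.{u}} {U : Set T} (hU : IsOpen U)
    (h : T → Fib3 π)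
    (h1 : ContMDiffOn (𝓡 T.dim) (𝓡 X.dim) ∞ (fun t => (h t).1.1) U)
    (h2 : ContMDiffOn (𝓡 T.dim) (𝓡 X.dim) ∞ (fun t => (h t).1.2.1) U)
    (h3 : ContMDiffOn (𝓡 T.dim) (𝓡 X.dim) ∞ (fun t => (h t).1.2.2) U) :
    ContMDiffOn (𝓡 T.dim) (𝓡 s.mfd.dim) ∞ (fun t => (h t : s.mfd)) U := by
  let U' : TopologicalSpace.Opens T := ⟨U, hU⟩
  have key := (s.smooth_iff (T.opens U') fun t => h t.1).2
    ⟨fun t => (contMDiffAt_subtype_iff (I := 𝓡 T.dim)).2 (h1.contMDiffAt (hU.mem_nhds t.2)),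
      fun t => (contMDiffAt_subtype_iff (I := 𝓡 T.dim)).2 (h2.contMDiffAt (hU.mem_nhds t.2)),
      fun t => (contMDiffAt_subtype_iff (I := 𝓡 T.dim)).2 (h3.contMDiffAt (hU.mem_nhds t.2))⟩
  exact fun t ht => ((contMDiffAt_subtype_iff (I := 𝓡 T.dim)).1 (key ⟨t, ht⟩)).contMDiffWithinAt

theorem FibreSquare.smooth_fst (s : FibreSquare π) : Smooth (X := s.mfd) fun p => p.1.1 :=
  ((s.smooth_iff s.mfd id).1 contMDiff_id).1

theorem FibreSquare.smooth_snd (s : FibreSquare π) : Smooth (X := s.mfd) fun p => p.1.2 :=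
  ((s.smooth_iff s.mfd id).1 contMDiff_id).2

end FibreProducts

/-! ### Pullback of forms to normed spaces and naturality of the exterior derivative -/

section AlternatingMaps

variable {E F V : Type*} [NormedAddCommGroup E] [NormedSpace ℝ E] [NormedAddCommGroup F]
  [NormedSpace ℝ F] [NormedAddCommGroup V] [NormedSpace ℝ V]

/-- The normalised antisymmetrisation of multilinear maps, a continuous linear retraction onto the
alternating maps. -/
def alternatizationL (k : ℕ) :
    ContinuousMultilinearMap ℝ (fun _ : Fin k => E) V →L[ℝ] E [⋀^Fin k]→L[ℝ] V :=
  LinearMap.mkContinuous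
    { toFun := fun f => ((k.factorial : ℝ)⁻¹) • ContinuousMultilinearMap.alternatization f
      map_add' := fun f g => by rw [map_add, smul_add]
      map_smul' := fun c f => by
        ext v
        simp [ContinuousMultilinearMap.alternatization_apply_apply, Finset.smul_sum,
          smul_comm _ c] }
    1 fun f => by
      refine ContinuousAlternatingMap.opNorm_le_bound _ (by positivity) fun v => ?_
      have hk : (0 : ℝ) < k.factorial := by exact_mod_cast k.factorial_pos
      have h : ‖ContinuousMultilinearMap.alternatization f v‖ ≤
          k.factorial * (‖f‖ * ∏ i, ‖v i‖) := by
        rw [ContinuousMultilinearMap.alternatization_apply_apply]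
        refine (norm_sum_le_of_le (f := fun σ : Equiv.Perm (Fin k) =>
          Equiv.Perm.sign σ • f (v ∘ σ)) (n := fun _ => ‖f‖ * ∏ i, ‖v i‖) _ fun σ _ => ?_).trans ?_
        · have h1 : ‖Equiv.Perm.sign σ • f (v ∘ σ)‖ = ‖f (v ∘ σ)‖ := by
            rcases Int.units_eq_one_or (Equiv.Perm.sign σ) with h | h <;> simp [h]
          rw [h1]
          refine (f.le_opNorm _).trans_eq ?_
          congr 1
          exact Equiv.prod_comp σ fun i => ‖v i‖
        · simp [Fintype.card_perm]
      simp only [LinearMap.coe_mk, AddHom.coe_mk, ContinuousAlternatingMap.smul_apply, norm_smul,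
        norm_inv, RCLike.norm_natCast]
      rw [inv_mul_le_iff₀ hk]
      linarith

theorem alternatizationL_toContinuousMultilinearMap {k : ℕ} (f : E [⋀^Fin k]→L[ℝ] V) :
    alternatizationL k f.toContinuousMultilinearMap = f := by
  have hk : (k.factorial : ℝ) ≠ 0 := by exact_mod_cast k.factorial_ne_zero
  have h : ∀ (v : Fin k → E) (σ : Equiv.Perm (Fin k)),
      Equiv.Perm.sign σ • f (v ∘ σ) = f v := fun v σ => by
    have := f.toAlternatingMap.map_perm v σ
    rw [show f (v ∘ σ) = Equiv.Perm.sign σ • f v from this, smul_smul, Int.units_mul_self, one_smul]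
  ext v
  simp only [alternatizationL, LinearMap.mkContinuous_apply, LinearMap.coe_mk, AddHom.coe_mk,
    ContinuousAlternatingMap.smul_apply, ContinuousMultilinearMap.alternatization_apply_apply,
    ContinuousAlternatingMap.coe_toContinuousMultilinearMap, h]
  rw [Finset.sum_const, Finset.card_univ, Fintype.card_perm, Fintype.card_fin,
    ← Nat.cast_smul_eq_nsmul ℝ, smul_smul, inv_mul_cancel₀ hk, one_smul]

/-- Pulling back an alternating map along a linear map is smooth in both arguments; the retraction
`alternatizationL` transfers this from multilinear maps. -/
theorem contDiff_compContinuousLinearMap {k : ℕ} {n : ℕ∞ω} :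
    ContDiff ℝ n fun p : (F [⋀^Fin k]→L[ℝ] V) × (E →L[ℝ] F) =>
      p.1.compContinuousLinearMap p.2 := by
  have h1 : ContDiff ℝ n fun p : (F [⋀^Fin k]→L[ℝ] V) × (E →L[ℝ] F) =>
      ContinuousMultilinearMap.compContinuousLinearMapContinuousMultilinear ℝ (fun _ : Fin k => E)
        (fun _ => F) V (fun _ => p.2) :=
    (ContinuousMultilinearMap.contDiff _).comp (contDiff_pi.2 fun _ => contDiff_snd)
  have h2 : ContDiff ℝ n fun p : (F [⋀^Fin k]→L[ℝ] V) × (E →L[ℝ] F) =>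
      p.1.toContinuousMultilinearMap :=
    (ContinuousAlternatingMap.toContinuousMultilinearMapLI (𝕜 := ℝ) (E := F) (F := V)
      (ι := Fin k)).contDiff.comp contDiff_fst
  have h3 := (alternatizationL k).contDiff.comp (h1.clm_apply h2)
  convert h3 using 1
  funext p
  exact (alternatizationL_toContinuousMultilinearMap _).symm

end AlternatingMaps

theorem minSmoothness_two_le : minSmoothness ℝ 2 ≤ ∞ := by
  simpa using (WithTop.coe_le_coe.2 le_top : ((2 : ℕ∞) : ℕ∞ω) ≤ ∞)

section Pullback

variable {V : Type} [NormedAddCommGroup V] [NormedSpace ℝ V]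
variable {E : Type*} [NormedAddCommGroup E] [NormedSpace ℝ E] {X Y : Mfd.{u}} {k : ℕ}

/-- The pullback of a form on a manifold along a map from a normed space. -/
def DForm.pullE (f : E → X) (w : DForm X k V) : E → E [⋀^Fin k]→L[ℝ] V :=
  fun e => (w (f e)).compContinuousLinearMap (mfderiv 𝓘(ℝ, E) (𝓡 X.dim) f e)

theorem DForm.pullE_congr {f g : E → X} {e : E} (h : f =ᶠ[𝓝 e] g) (w : DForm X k V) :
    w.pullE f e = w.pullE g e := by
  have h1 := h.self_of_nhds
  have h2 : mfderiv 𝓘(ℝ, E) (𝓡 X.dim) f e = mfderiv 𝓘(ℝ, E) (𝓡 X.dim) g e := h.mfderiv_eq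
  simp only [pullE]
  rw [h2, h1]

theorem DForm.pullE_pullback {f : E → X} {g : X → Y} {e : E}
    (hf : MDifferentiableAt 𝓘(ℝ, E) (𝓡 X.dim) f e)
    (hg : MDifferentiableAt (𝓡 X.dim) (𝓡 Y.dim) g (f e)) (w : DForm Y k V) :
    (w.pullback g).pullE f e = w.pullE (g ∘ f) e := by
  simp only [pullE, mfderiv_comp e hg hf]
  rfl

/-- Near a point, the pullback of a form is the Euclidean pullback of its expression in the
preferred chart at the image of the point. -/
theorem DForm.pullE_eventuallyEq {f : E → X} {e : E}
    (hf : ContMDiffAt 𝓘(ℝ, E) (𝓡 X.dim) ∞ f e) (w : DForm X k V) :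
    w.pullE f =ᶠ[𝓝 e] fun y => (w.inChart (f e)
      (chartAt (EuclideanSpace ℝ (Fin X.dim)) (f e) (f y))).compContinuousLinearMap
      (fderiv ℝ (fun y => chartAt (EuclideanSpace ℝ (Fin X.dim)) (f e) (f y)) y) := by
  set ψ := chartAt (EuclideanSpace ℝ (Fin X.dim)) (f e)
  have hsrc : ∀ᶠ y in 𝓝 e, f y ∈ ψ.source :=
    hf.continuousAt.eventually (ψ.open_source.mem_nhds (mem_chart_source _ _))
  have hsm : ∀ᶠ y in 𝓝 e, ContMDiffAt 𝓘(ℝ, E) (𝓡 X.dim) 1 f y := by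
    obtain ⟨u, hu, hfu⟩ := (contMDiffAt_iff_contMDiffOn_nhds (by simp)).1
      (hf.of_le (by exact_mod_cast le_top) : ContMDiffAt 𝓘(ℝ, E) (𝓡 X.dim) 1 f e)
    exact (eventually_mem_nhds_iff.2 hu).mono fun y hy => hfu.contMDiffAt hy
  filter_upwards [hsrc.eventually_nhds, hsm] with y hy hyf
  have hy' := hy.self_of_nhds
  have h1 : f =ᶠ[𝓝 y] ψ.symm ∘ fun y => ψ (f y) := hy.mono fun z hz => (ψ.left_inv hz).symm
  rw [DForm.pullE_congr h1]
  have hd : MDifferentiableAt 𝓘(ℝ, E) 𝓘(ℝ, EuclideanSpace ℝ (Fin X.dim)) (fun y => ψ (f y)) y :=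
    (((contMDiffOn_chart (n := 1)).contMDiffAt (ψ.open_source.mem_nhds hy')).comp y
      hyf).mdifferentiableAt (by simp)
  have hd' : MDifferentiableAt 𝓘(ℝ, EuclideanSpace ℝ (Fin X.dim)) (𝓡 X.dim) ψ.symm (ψ (f y)) :=
    ((contMDiffOn_chart_symm (n := ∞)).contMDiffAt
      (ψ.open_target.mem_nhds (ψ.map_source hy'))).mdifferentiableAt (by simp)
  simp only [DForm.pullE, DForm.inChart]
  rw [mfderiv_comp y hd' hd, mfderiv_eq_fderiv]
  rfl

theorem DForm.contDiffAt_pullE {f : E → X} {e : E} (hf : ContMDiffAt 𝓘(ℝ, E) (𝓡 X.dim) ∞ f e)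
    {w : DForm X k V} {U : Set X} (hw : w.SmoothOn U) (he : f e ∈ U) :
    ContDiffAt ℝ ∞ (w.pullE f) e := by
  refine ContDiffAt.congr_of_eventuallyEq ?_ (DForm.pullE_eventuallyEq hf w)
  have h1 : ContDiffAt ℝ ∞ (fun y => chartAt (EuclideanSpace ℝ (Fin X.dim)) (f e) (f y)) e :=
    ((contMDiffAt_of_mem_maximalAtlas (IsManifold.chart_mem_maximalAtlas _)
      (mem_chart_source _ _)).comp e hf).contDiffAt
  exact contDiff_compContinuousLinearMap.contDiffAt.comp e
    (((hw _ he).comp e h1).prodMk (h1.fderiv_right le_rfl))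

/-- The exterior derivative is natural. -/
theorem DForm.extDeriv_pullE {f : E → X} {e : E} (hf : ContMDiffAt 𝓘(ℝ, E) (𝓡 X.dim) ∞ f e)
    {w : DForm X k V} {U : Set X} (hw : w.SmoothOn U) (he : f e ∈ U) :
    extDeriv (w.pullE f) e = w.d.pullE f e := by
  have hc : ContMDiffAt (𝓡 X.dim) 𝓘(ℝ, EuclideanSpace ℝ (Fin X.dim)) ∞
      (chartAt (EuclideanSpace ℝ (Fin X.dim)) (f e)) (f e) :=
    contMDiffAt_of_mem_maximalAtlas (IsManifold.chart_mem_maximalAtlas _) (mem_chart_source _ _)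
  have h1 : ContDiffAt ℝ ∞ (fun y => chartAt (EuclideanSpace ℝ (Fin X.dim)) (f e) (f y)) e :=
    (hc.comp e hf).contDiffAt
  have hdw : DifferentiableAt ℝ (w.inChart (f e))
      (chartAt (EuclideanSpace ℝ (Fin X.dim)) (f e) (f e)) := (hw _ he).differentiableAt (by simp)
  rw [(DForm.pullE_eventuallyEq hf w).extDeriv_eq,
    extDeriv_pullback (f := fun y => chartAt (EuclideanSpace ℝ (Fin X.dim)) (f e) (f y)) hdw h1
      minSmoothness_two_le]
  have h2 : fderiv ℝ (fun y => chartAt (EuclideanSpace ℝ (Fin X.dim)) (f e) (f y)) e =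
      (mfderiv (𝓡 X.dim) 𝓘(ℝ, EuclideanSpace ℝ (Fin X.dim))
        (chartAt (EuclideanSpace ℝ (Fin X.dim)) (f e)) (f e)).comp
        (mfderiv 𝓘(ℝ, E) (𝓡 X.dim) f e) := by
    rw [← mfderiv_eq_fderiv]
    exact mfderiv_comp e (hc.mdifferentiableAt (by simp)) (hf.mdifferentiableAt (by simp))
  rw [h2]
  rfl

theorem DForm.inChart_eq_pullE (w : DForm X k V) (x : X) :
    w.inChart x = w.pullE (chartAt (EuclideanSpace ℝ (Fin X.dim)) x).symm := rfl

/-- A form is determined at a point by its expression in the chart there. -/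
theorem DForm.apply_eq_of_inChart (w : DForm X k V) (x : X) :
    w x = (w.inChart x (chartAt (EuclideanSpace ℝ (Fin X.dim)) x x)).compContinuousLinearMap
      (mfderiv (𝓡 X.dim) 𝓘(ℝ, EuclideanSpace ℝ (Fin X.dim))
        (chartAt (EuclideanSpace ℝ (Fin X.dim)) x) x) := by
  set ψ := chartAt (EuclideanSpace ℝ (Fin X.dim)) x
  have hx : x ∈ ψ.source := mem_chart_source _ _
  have hd : MDifferentiableAt (𝓡 X.dim) 𝓘(ℝ, EuclideanSpace ℝ (Fin X.dim)) ψ x :=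
    ((contMDiffOn_chart (n := ∞)).contMDiffAt (ψ.open_source.mem_nhds hx)).mdifferentiableAt
      (by simp)
  have hd' : MDifferentiableAt 𝓘(ℝ, EuclideanSpace ℝ (Fin X.dim)) (𝓡 X.dim) ψ.symm (ψ x) :=
    ((contMDiffOn_chart_symm (n := ∞)).contMDiffAt
      (ψ.open_target.mem_nhds (ψ.map_source hx))).mdifferentiableAt (by simp)
  have h : (mfderiv 𝓘(ℝ, EuclideanSpace ℝ (Fin X.dim)) (𝓡 X.dim) ψ.symm (ψ x)).comp
      (mfderiv (𝓡 X.dim) 𝓘(ℝ, EuclideanSpace ℝ (Fin X.dim)) ψ x) =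
      ContinuousLinearMap.id ℝ _ := by
    rw [← mfderiv_comp x hd' hd, ← mfderiv_id]
    exact Filter.EventuallyEq.mfderiv_eq
      (Filter.mem_of_superset (ψ.open_source.mem_nhds hx) fun z hz => ψ.left_inv hz)
  have h' : ∀ y (hy : y = x) (v : Fin k → EuclideanSpace ℝ (Fin X.dim)), w y v = w x v := by
    rintro _ rfl _; rfl
  ext v
  have h2 : ∀ i, mfderiv 𝓘(ℝ, EuclideanSpace ℝ (Fin X.dim)) (𝓡 X.dim) ψ.symm (ψ x)
      (mfderiv (𝓡 X.dim) 𝓘(ℝ, EuclideanSpace ℝ (Fin X.dim)) ψ x (v i)) = v i := fun i =>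
    DFunLike.congr_fun h (v i)
  refine Eq.trans ?_ (h' _ (ψ.left_inv hx) _).symm
  exact congrArg (w x) (funext fun i => (h2 i).symm)

end Pullback

/-! ### Unitary matrices and the form `tr (m⁻¹ dm)` -/

section UnitaryMatrices

open Matrix

/-- Antisymmetry of `tr (m⁻¹ dm ∧ m⁻¹ dm)`, written with `m⁻¹ = mᴴ`. -/
theorem trace_conjTranspose_mul_comm {n p : Type*} [Fintype n] [Fintype p] [DecidableEq n]
    {m D D' : Matrix n p ℂ} (h : m * mᴴ = 1) (hD : Dᴴ * m + mᴴ * D = 0)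
    (hD' : D'ᴴ * m + mᴴ * D' = 0) : (Dᴴ * D').trace = (D'ᴴ * D).trace := by
  have e : ∀ {A B : Matrix n p ℂ}, Aᴴ * m + mᴴ * A = 0 →
      Aᴴ * B = -((mᴴ * A) * (mᴴ * B)) := fun {A B} hA => by
    have h1 : Aᴴ * m = -(mᴴ * A) := eq_neg_of_add_eq_zero_left hA
    calc Aᴴ * B = Aᴴ * (m * mᴴ) * B := by rw [h, Matrix.mul_one]
      _ = (Aᴴ * m) * (mᴴ * B) := by simp only [Matrix.mul_assoc]
      _ = _ := by rw [h1, Matrix.neg_mul]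
  rw [e hD, e hD', Matrix.trace_neg, Matrix.trace_neg, Matrix.trace_mul_comm]

/-- The matrix of a unitary map with respect to orthonormal bases is unitary. -/
theorem matrix_of_isometry {V W : Type*} [NormedAddCommGroup V] [InnerProductSpace ℂ V]
    [NormedAddCommGroup W] [InnerProductSpace ℂ W] {κ κ' : Type*} [Fintype κ] [Fintype κ']
    [DecidableEq κ] [DecidableEq κ'] {b : κ → V} {c : κ' → W} (hb : Orthonormal ℂ b)
    (hb' : Submodule.span ℂ (Set.range b) = ⊤) (hc : Orthonormal ℂ c)
    (hc' : Submodule.span ℂ (Set.range c) = ⊤) (φ : V ≃ₗᵢ[ℂ] W) :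
    (Matrix.of fun i j => inner ℂ (c i) (φ (b j)))ᴴ * (Matrix.of fun i j => inner ℂ (c i) (φ (b j)))
      = 1 ∧
    (Matrix.of fun i j => inner ℂ (c i) (φ (b j))) * (Matrix.of fun i j => inner ℂ (c i) (φ (b j)))ᴴ
      = 1 := by
  let B := (OrthonormalBasis.mk hb hb'.ge).map φ
  let C := OrthonormalBasis.mk hc hc'.ge
  have hB : ∀ j, B j = φ (b j) := fun j => by simp [B]
  have hC : ∀ j, C j = c j := fun j => by simp [C]
  constructor
  · ext j j'
    simp only [Matrix.mul_apply, Matrix.conjTranspose_apply, Matrix.of_apply, ← hB, ← hC]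
    rw [Matrix.one_apply, ← orthonormal_iff_ite.1 B.orthonormal j j', ← C.sum_inner_mul_inner]
    simp
  · ext j j'
    simp only [Matrix.mul_apply, Matrix.conjTranspose_apply, Matrix.of_apply, ← hB, ← hC]
    rw [Matrix.one_apply, ← orthonormal_iff_ite.1 C.orthonormal j j', ← B.sum_inner_mul_inner]
    simp

end UnitaryMatrices

section MaurerCartan

variable {E : Type*} [NormedAddCommGroup E] [NormedSpace ℝ E]

/-- The exterior derivative of a 1-form. -/
theorem extDeriv_ofSubsingleton {V : Type*} [NormedAddCommGroup V] [NormedSpace ℝ V]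
    {l : E → E →L[ℝ] V} {e : E} (h : DifferentiableAt ℝ l e) (v : Fin 2 → E) :
    extDeriv (fun y => ContinuousAlternatingMap.ofSubsingleton ℝ E V (0 : Fin 1) (l y)) e v =
      fderiv ℝ l e (v 0) (v 1) - fderiv ℝ l e (v 1) (v 0) := by
  have h1 : fderiv ℝ (fun y => ContinuousAlternatingMap.ofSubsingleton ℝ E V (0 : Fin 1) (l y)) e =
      ((ContinuousAlternatingMap.ofSubsingletonLIE (𝕜 := ℝ) (E := E) (F := V)
        (0 : Fin 1)).toContinuousLinearEquiv : (E →L[ℝ] V) →L[ℝ] _).comp (fderiv ℝ l e) :=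
    ((ContinuousAlternatingMap.ofSubsingletonLIE (𝕜 := ℝ) (E := E) (F := V)
      (0 : Fin 1)).toContinuousLinearEquiv.hasFDerivAt.comp e h.hasFDerivAt).fderiv
  rw [extDeriv, h1, ContinuousAlternatingMap.alternatizeUncurryFin_apply, Fin.sum_univ_two]
  simp [Fin.removeNth, sub_eq_add_neg]
  rfl

/-- The 1-form `tr (mᴴ dm)`. -/
def traceForm {n p : Type*} [Fintype n] [Fintype p] (m : n → p → E → ℂ) (e : E) : E →L[ℝ] ℂ :=
  ∑ b, ∑ a, star (m b a e) • fderiv ℝ (m b a) e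

variable {n p : Type*} [Fintype n] [Fintype p] {m : n → p → E → ℂ} {e : E}

theorem contDiffAt_traceForm (hm : ∀ b a, ContDiffAt ℝ ∞ (m b a) e) :
    ContDiffAt ℝ ∞ (traceForm m) e := by
  unfold traceForm
  refine ContDiffAt.sum fun b _ => ContDiffAt.sum fun a _ => ?_
  exact ((starL' ℝ : ℂ ≃L[ℝ] ℂ).contDiff.contDiffAt.comp e (hm b a)).smul
    ((hm b a).fderiv_right le_rfl)

/-- For a smooth family `m` of unitary matrices the form `tr (m⁻¹ dm)` is closed. -/
theorem extDeriv_traceForm [DecidableEq n] [DecidableEq p]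
    (hm : ∀ b a, ContDiffAt ℝ ∞ (m b a) e)
    (h1 : ∀ᶠ y in 𝓝 e, (Matrix.of fun b a => m b a y).conjTranspose *
      (Matrix.of fun b a => m b a y) = 1)
    (h2 : (Matrix.of fun b a => m b a e) * (Matrix.of fun b a => m b a e).conjTranspose = 1) :
    extDeriv (fun y => ContinuousAlternatingMap.ofSubsingleton ℝ E ℂ (0 : Fin 1) (traceForm m y)) e
      = 0 := by
  have hd : ∀ b a, DifferentiableAt ℝ (m b a) e := fun b a => (hm b a).differentiableAt (by simp)
  have hs : ∀ b a, HasFDerivAt (fun y => star (m b a y))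
      ((starL' ℝ : ℂ ≃L[ℝ] ℂ).toContinuousLinearMap.comp (fderiv ℝ (m b a) e)) e := fun b a =>
    (starL' ℝ : ℂ ≃L[ℝ] ℂ).hasFDerivAt.comp e (hd b a).hasFDerivAt
  have hdd : ∀ b a, DifferentiableAt ℝ (fderiv ℝ (m b a)) e := fun b a =>
    ((hm b a).fderiv_right (m := ∞) le_rfl).differentiableAt (by simp)
  have hF : fderiv ℝ (traceForm m) e = ∑ b, ∑ a, (star (m b a e) • fderiv ℝ (fderiv ℝ (m b a)) e +
      ((starL' ℝ : ℂ ≃L[ℝ] ℂ).toContinuousLinearMap.comp (fderiv ℝ (m b a) e)).smulRight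
        (fderiv ℝ (m b a) e)) := by
    unfold traceForm
    exact (HasFDerivAt.fun_sum fun b _ => HasFDerivAt.fun_sum fun a _ =>
      (hs b a).fun_smul (hdd b a).hasFDerivAt).fderiv
  -- `D u` is the derivative of `m` in the direction `u`; differentiating `mᴴ m = 1` gives `hD`
  let D : E → Matrix n p ℂ := fun u => Matrix.of fun b a => fderiv ℝ (m b a) e u
  have hD : ∀ u, (D u).conjTranspose * (Matrix.of fun b a => m b a e) +
      (Matrix.of fun b a => m b a e).conjTranspose * D u = 0 := fun u => by
    ext a a'
    have h3 : HasFDerivAt (fun y => ∑ b, star (m b a y) * m b a' y) _ e :=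
      HasFDerivAt.fun_sum fun b _ => (hs b a).mul (hd b a').hasFDerivAt
    have h4 : (fun y => ∑ b, star (m b a y) * m b a' y) =ᶠ[𝓝 e]
        fun _ => (1 : Matrix p p ℂ) a a' := h1.mono fun y hy => by
      rw [← hy]
      simp [Matrix.mul_apply]
    have h5 := (h3.congr_of_eventuallyEq h4.symm).unique (hasFDerivAt_const _ e)
    have h6 := DFunLike.congr_fun h5 u
    simp only [sum_apply] at h6
    rw [Matrix.add_apply, Matrix.mul_apply, Matrix.mul_apply, ← Finset.sum_add_distrib]
    simp only [Matrix.zero_apply]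
    refine Eq.trans ?_ h6
    refine Finset.sum_congr rfl fun b _ => ?_
    simp [D]
    ring
  ext v
  rw [extDeriv_ofSubsingleton ((contDiffAt_traceForm hm).differentiableAt (by simp)), hF]
  have hsym : ∀ b a, fderiv ℝ (fderiv ℝ (m b a)) e (v 0) (v 1) =
      fderiv ℝ (fderiv ℝ (m b a)) e (v 1) (v 0) := fun b a =>
    ((hm b a).isSymmSndFDerivAt minSmoothness_two_le) _ _
  have ht := trace_conjTranspose_mul_comm h2 (hD (v 0)) (hD (v 1))
  have hsum : ∀ u w, ((D u).conjTranspose * D w).trace = ∑ b, ∑ a,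
      star (fderiv ℝ (m b a) e u) * fderiv ℝ (m b a) e w := fun u w => by
    rw [Finset.sum_comm]
    simp [Matrix.trace, Matrix.mul_apply, D]
  rw [hsum, hsum] at ht
  simp only [sum_apply, add_apply,
    smul_apply, ContinuousLinearMap.smulRight_apply, Finset.sum_add_distrib,
    hsym]
  simp only [ContinuousLinearMap.comp_apply, smul_eq_mul]
  erw [ht]
  simp

end MaurerCartan

/-! ### The trace of a connection under unitary parallel isomorphisms -/

namespace BundleData

variable {X X' : Mfd.{u}}

/-- The local frame `i` is an orthonormal basis of the fibre at `x`. -/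
structure IsFrameAt (E : BundleData X) (i : E.ι) (x : X) : Prop where
  orthonormal : Orthonormal ℂ (E.frame i x)
  span : Submodule.span ℂ (Set.range (E.frame i x)) = ⊤

theorem IsHermitean.isFrameAt {E : BundleData X} (h : E.IsHermitean) {i : E.ι} {x : X}
    (hx : x ∈ E.U i) : E.IsFrameAt i x := ⟨h.orthonormal i x hx, h.span i x hx⟩

namespace IsFrameAt

variable {E F : BundleData X} {i : E.ι} {j : F.ι} {x : X}

/-- The orthonormal basis given by a frame. -/
def basis (h : E.IsFrameAt i x) : OrthonormalBasis (E.κ i) ℂ (E.fiber x) :=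
  OrthonormalBasis.mk h.orthonormal h.span.ge

theorem basis_apply (h : E.IsFrameAt i x) (a : E.κ i) : h.basis a = E.frame i x a := by
  simp [basis]

theorem finrank_eq (h : E.IsFrameAt i x) : Module.finrank ℂ (E.fiber x) = Fintype.card (E.κ i) :=
  Module.finrank_eq_card_basis h.basis.toBasis

theorem pullback {f : X' → X} {x : X'} (h : E.IsFrameAt i (f x)) :
    (E.pullback f).IsFrameAt i x := ⟨h.orthonormal, h.span⟩

theorem tensor (h : E.IsFrameAt i x) (h' : F.IsFrameAt j x) :
    (E.tensor F).IsFrameAt (i, j) x := by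
  have e : (E.tensor F).frame (i, j) x = h.basis.tensorProduct h'.basis := by
    funext a
    refine Eq.trans ?_ (OrthonormalBasis.tensorProduct_apply' h.basis h'.basis a).symm
    rw [basis_apply, basis_apply]
    rfl
  constructor
  · rw [e]
    exact (h.basis.tensorProduct h'.basis).orthonormal
  · rw [e]
    have := (h.basis.tensorProduct h'.basis).toBasis.span_eq
    rwa [OrthonormalBasis.coe_toBasis] at this

/-- The matrix of a unitary isomorphism in orthonormal frames is unitary. -/
theorem coef_unitary (h : E.IsFrameAt i x) (h' : F.IsFrameAt j x)
    (φ : ∀ x, E.fiber x ≃ₗᵢ[ℂ] F.fiber x) :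
    let m : Matrix (F.κ j) (E.κ i) ℂ :=
      Matrix.of fun b a => coef E F (fun x => (φ x).toLinearEquiv.toLinearMap) i j b a x
    m.conjTranspose * m = 1 ∧ m * m.conjTranspose = 1 :=
  matrix_of_isometry h.orthonormal h.span h'.orthonormal h'.span (φ x)

end IsFrameAt

/-- The trace of the connection matrix in a local frame. -/
def trConn (E : BundleData X) (i : E.ι) : DForm X 1 ℂ := ∑ a, E.conn i a a

theorem _root_.Gerbe.DForm.smoothOn_sum {V : Type} [NormedAddCommGroup V] [NormedSpace ℝ V]
    {k : ℕ} {α : Type*} (s : Finset α) {w : α → DForm X k V} {U : Set X}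
    (h : ∀ a, (w a).SmoothOn U) : (∑ a ∈ s, w a).SmoothOn U := by
  classical
  induction s using Finset.induction_on with
  | empty => simpa using DForm.SmoothOn.zero U
  | insert a s ha ih => simpa [Finset.sum_insert ha] using (h a).add ih

theorem IsHermitean.trConn_smooth {E : BundleData X} (h : E.IsHermitean) (i : E.ι) :
    (E.trConn i).SmoothOn (E.U i) :=
  DForm.smoothOn_sum _ fun a => h.conn_smooth i a a

theorem _root_.Gerbe.DForm.sum_apply {V : Type} [NormedAddCommGroup V] [NormedSpace ℝ V] {k : ℕ}
    {α : Type*} (s : Finset α) (w : α → DForm X k V) (x : X) :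
    (∑ a ∈ s, w a) x = ∑ a ∈ s, w a x :=
  Finset.sum_apply x s w

theorem trConn_apply (E : BundleData X) (i : E.ι) (x : X) (v : Fin 1 → Tan X x) :
    E.trConn i x v = ∑ a, E.conn i a a x v := by
  rw [trConn, DForm.sum_apply]
  exact ContinuousAlternatingMap.sum_apply _ _

theorem trConn_pullback (E : BundleData X) (f : X' → X) (i : E.ι) :
    (E.pullback f).trConn i = (E.trConn i).pullback f := by
  funext x
  ext v
  exact ((E.pullback f).trConn_apply i x v).trans (E.trConn_apply i (f x) _).symm

/-- The trace of the connection of a tensor product with a line bundle. -/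
theorem trConn_tensor (E F : BundleData X) (i : E.ι) (j : F.ι) [Unique (F.κ j)] :
    (E.tensor F).trConn (i, j) =
      E.trConn i + (Fintype.card (E.κ i) : ℝ) • F.conn j default default := by
  change ∑ a : E.κ i × F.κ j, (E.tensor F).conn (i, j) a a = _
  have h : ∀ a : E.κ i × F.κ j, (E.tensor F).conn (i, j) a a =
      E.conn i a.1 a.1 + F.conn j a.2 a.2 := fun a => by simp [BundleData.tensor]
  simp only [h, Fintype.sum_prod_type, Finset.sum_add_distrib, Finset.univ_unique,
    Finset.sum_singleton, Finset.sum_const, Finset.card_univ, Finset.card_singleton, one_smul,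
    trConn]
  rw [Nat.cast_smul_eq_nsmul]

/-- A unitary parallel isomorphism with matrix `m` changes the trace of the connection by
`tr (m⁻¹ dm)`. -/
theorem IsUnitaryParallel.trConn_eq {E F : BundleData X}
    {φ : ∀ x, E.fiber x ≃ₗᵢ[ℂ] F.fiber x} (hφ : IsUnitaryParallel E F φ) {i : E.ι} {j : F.ι}
    {x : X} (hx : x ∈ E.U i ∩ F.U j) (h : E.IsFrameAt i x) (h' : F.IsFrameAt j x) (v : Tan X x) :
    E.trConn i x ![v] = F.trConn j x ![v] + ∑ b, ∑ a,
      star (coef E F (fun x => (φ x).toLinearEquiv.toLinearMap) i j b a x) *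
        derivAlong (coef E F (fun x => (φ x).toLinearEquiv.toLinearMap) i j b a) x v := by
  set m := coef E F (fun x => (φ x).toLinearEquiv.toLinearMap) i j
  let N : Matrix (F.κ j) (E.κ i) ℂ := Matrix.of fun b a => m b a x
  let AE : Matrix (E.κ i) (E.κ i) ℂ := Matrix.of fun c a => E.conn i c a x ![v]
  let AF : Matrix (F.κ j) (F.κ j) ℂ := Matrix.of fun b c => F.conn j b c x ![v]
  let D : Matrix (F.κ j) (E.κ i) ℂ := Matrix.of fun b a => derivAlong (m b a) x v
  obtain ⟨h1, h2⟩ : N.conjTranspose * N = 1 ∧ N * N.conjTranspose = 1 := h.coef_unitary h' φ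
  have hp : D + AF * N = N * AE := by
    ext b a
    simpa [Matrix.mul_apply, N, AE, AF, D] using hφ.parallel i j b a x hx v
  have ht : AE.trace = AF.trace + (N.conjTranspose * D).trace := by
    have h3 : AE = N.conjTranspose * D + N.conjTranspose * (AF * N) := by
      rw [← Matrix.mul_add, hp, ← Matrix.mul_assoc, h1, Matrix.one_mul]
    rw [h3, Matrix.trace_add, ← Matrix.mul_assoc, Matrix.trace_mul_comm _ N, ← Matrix.mul_assoc,
      h2, Matrix.one_mul, add_comm]
  rw [trConn_apply, trConn_apply, Finset.sum_comm]
  simpa [Matrix.trace, Matrix.mul_apply, N, AE, AF, D] using ht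

variable {T : Type*} [NormedAddCommGroup T] [NormedSpace ℝ T]

/-- Isomorphic bundles have the same trace of the curvature, in terms of pullbacks to a normed
space. -/
theorem IsUnitaryParallel.extDeriv_trConn_eq {E F : BundleData X}
    {φ : ∀ x, E.fiber x ≃ₗᵢ[ℂ] F.fiber x} (hφ : IsUnitaryParallel E F φ) {i : E.ι} {j : F.ι}
    {g : T → X} {W : Set T} (hW : IsOpen W) (hg : ContMDiffOn 𝓘(ℝ, T) (𝓡 X.dim) ∞ g W)
    (hU : IsOpen (E.U i ∩ F.U j))
    (hgW : ∀ t ∈ W, g t ∈ E.U i ∩ F.U j)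
    (h : ∀ t ∈ W, E.IsFrameAt i (g t)) (h' : ∀ t ∈ W, F.IsFrameAt j (g t)) {t : T} (ht : t ∈ W)
    (hF : DifferentiableAt ℝ ((F.trConn j).pullE g) t) :
    extDeriv ((E.trConn i).pullE g) t = extDeriv ((F.trConn j).pullE g) t := by
  set m := coef E F (fun x => (φ x).toLinearEquiv.toLinearMap) i j
  have hmg : ∀ b a, ∀ t ∈ W, ContDiffAt ℝ ∞ (m b a ∘ g) t := fun b a t ht =>
    (((hφ.smooth i j b a).contMDiffAt (hU.mem_nhds (hgW t ht))).comp t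
      (hg.contMDiffAt (hW.mem_nhds ht))).contDiffAt
  have key : (E.trConn i).pullE g =ᶠ[𝓝 t] (F.trConn j).pullE g + fun y =>
      ContinuousAlternatingMap.ofSubsingleton ℝ T ℂ (0 : Fin 1)
        (traceForm (fun b a => m b a ∘ g) y) := by
    filter_upwards [hW.mem_nhds ht] with y hy
    have hmd := (hg.contMDiffAt (hW.mem_nhds hy)).mdifferentiableAt (by simp)
    ext v
    have e : ∀ w : DForm X 1 ℂ, w.pullE g y v = w (g y) ![mfderiv 𝓘(ℝ, T) (𝓡 X.dim) g y (v 0)] :=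
      fun w => by
        refine congrArg (w (g y)) (funext fun k => ?_)
        fin_cases k
        rfl
    rw [Pi.add_apply, ContinuousAlternatingMap.add_apply, e, e,
      hφ.trConn_eq (hgW y hy) (h y hy) (h' y hy)]
    congr 1
    simp only [traceForm, ContinuousAlternatingMap.ofSubsingleton_apply_apply, sum_apply,
      smul_apply, smul_eq_mul]
    refine Finset.sum_congr rfl fun b _ => Finset.sum_congr rfl fun a _ => ?_
    congr 1
    have hma : MDifferentiableAt (𝓡 X.dim) 𝓘(ℝ, ℂ) (m b a) (g y) :=
      ((hφ.smooth i j b a).contMDiffAt (hU.mem_nhds (hgW y hy))).mdifferentiableAt (by simp)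
    rw [← mfderiv_eq_fderiv, mfderiv_comp y hma hmd]
    rfl
  have hdt : DifferentiableAt ℝ (fun y => ContinuousAlternatingMap.ofSubsingleton ℝ T ℂ (0 : Fin 1)
        (traceForm (fun b a => m b a ∘ g) y)) t :=
    (ContinuousAlternatingMap.ofSubsingletonLIE (𝕜 := ℝ) (E := T) (F := ℂ)
      (0 : Fin 1)).toContinuousLinearEquiv.differentiableAt.comp t
      ((contDiffAt_traceForm fun b a => hmg b a t ht).differentiableAt (by simp))
  rw [key.extDeriv_eq, extDeriv_add hF hdt, extDeriv_traceForm (fun b a => hmg b a t ht) ?_ ?_,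
    add_zero]
  · filter_upwards [hW.mem_nhds ht] with y hy
    exact ((h y hy).coef_unitary (h' y hy) φ).1
  · exact ((h t ht).coef_unitary (h' t ht) φ).2

end BundleData

/-! ### Closedness of the curvature, and local trivialisations of sections of a gerbe -/

/-- The inclusion `iℝ → ℂ`. -/
abbrev ImR.incl : ImR →L[ℝ] ℂ := (skewAdjoint.submodule ℝ ℂ).subtypeL

namespace BundleGerbe

variable {M : Mfd.{u}} {G : BundleGerbe M}

/-- The frames of the line bundle of a gerbe have one element. -/
theorem card_frame (G : BundleGerbe M) {k : G.L.ι} {p : G.Y2.mfd} (hp : p ∈ G.L.U k) :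
    Fintype.card (G.L.κ k) = 1 := by
  rw [← (G.hermitean.isFrameAt hp).finrank_eq, G.line]

/-- The curvature of a gerbe is closed. -/
theorem IsCurvature.mem_closedForms {H : DForm M 3 ImR} (hH : G.IsCurvature H) :
    H ∈ closedForms M 3 ImR := by
  refine ⟨hH.smooth, ?_⟩
  funext x
  obtain ⟨y, hy⟩ := G.proj_submersion.surjective x
  obtain ⟨U, s, hU, hxU, hs, -, hps⟩ := G.proj_submersion.exists_localSection y
  rw [hy] at hxU
  set ψ := chartAt (EuclideanSpace ℝ (Fin M.dim)) x
  have hx : x ∈ ψ.source := mem_chart_source _ _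
  have hψx : ψ.symm (ψ x) = x := ψ.left_inv hx
  let W := ψ.target ∩ ψ.symm ⁻¹' U
  have hW : IsOpen W := ψ.symm.isOpen_inter_preimage hU
  have hxW : ψ x ∈ W := ⟨ψ.map_source hx, by simpa [hψx] using hxU⟩
  have hφ : ContMDiffOn 𝓘(ℝ, EuclideanSpace ℝ (Fin M.dim)) (𝓡 M.dim) ∞ ψ.symm W :=
    (contMDiffOn_chart_symm (n := ∞)).mono fun _ h => h.1
  have hsφ : ContMDiffOn 𝓘(ℝ, EuclideanSpace ℝ (Fin M.dim)) (𝓡 G.Y.dim) ∞ (s ∘ ψ.symm) W :=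
    hs.comp hφ fun _ h => h.2
  have key : H.inChart x =ᶠ[𝓝 (ψ x)] extDeriv (G.B.pullE (s ∘ ψ.symm)) := by
    filter_upwards [hW.mem_nhds hxW] with e he
    have he' := hsφ.contMDiffAt (hW.mem_nhds he)
    rw [DForm.extDeriv_pullE he' G.B_smooth trivial, ← hH.pullback,
      DForm.pullE_pullback (he'.mdifferentiableAt (by simp))
        (G.proj_submersion.smooth.mdifferentiable (by simp) _)]
    refine DForm.pullE_congr ?_ H
    filter_upwards [hW.mem_nhds he] with e he
    exact (hps _ he.2).symm
  have h0 : extDeriv (H.inChart x) (ψ x) = 0 := by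
    rw [key.extDeriv_eq]
    exact extDeriv_extDeriv_apply (DForm.contDiffAt_pullE
      (hsφ.contMDiffAt (hW.mem_nhds hxW)) G.B_smooth trivial) minSmoothness_two_le
  change (extDeriv (H.inChart x) (ψ x)).compContinuousLinearMap _ = 0
  rw [h0]
  rfl

namespace Section

variable (S : G.Section)

/-- A section of `Z → M` which is smooth on an open set `U` and takes values there in the domain of
a local frame of `E`. The section is defined on all of `M`, with no condition of smoothness outside
`U`; such an extension of a local section exists because `Z → M` is surjective. -/
structure LocalTriv where
  U : Set M
  isOpen : IsOpen U
  s : M → S.Z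
  proj_s : ∀ x, G.proj (S.ζ (s x)) = x
  smooth : ContMDiffOn (𝓡 M.dim) (𝓡 S.Z.dim) ∞ s U
  i : S.E.ι
  mem : ∀ x ∈ U, s x ∈ S.E.U i

theorem surjective : Function.Surjective fun z => G.proj (S.ζ z) :=
  G.proj_submersion.surjective.comp S.ζ_submersion.surjective

theorem exists_localTriv (x : M) : ∃ D : S.LocalTriv, x ∈ D.U := by
  classical
  obtain ⟨z, hz⟩ := S.surjective x
  obtain ⟨i, hi⟩ := S.hermitean.cover z
  obtain ⟨V, t, hV, hzV, ht, htz, hζt⟩ := S.ζ_submersion.exists_localSection z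
  obtain ⟨U, s, hU, hxU, hs, hsx, hps⟩ := G.proj_submersion.exists_localSection (S.ζ z)
  change G.proj (S.ζ z) = x at hz
  rw [hz] at hxU hsx
  have hU1 : IsOpen (U ∩ s ⁻¹' V) := hs.continuousOn.isOpen_inter_preimage hU hV
  have hts : ContMDiffOn (𝓡 M.dim) (𝓡 S.Z.dim) ∞ (t ∘ s) (U ∩ s ⁻¹' V) :=
    ht.comp (hs.mono fun _ h => h.1) fun _ h => h.2
  let W := (U ∩ s ⁻¹' V) ∩ (t ∘ s) ⁻¹' S.E.U i
  have hW : IsOpen W := hts.continuousOn.isOpen_inter_preimage hU1 (S.hermitean.isOpen i)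
  -- outside `W` the values of the section are arbitrary
  let σ : M → S.Z := fun y => if y ∈ W then t (s y) else (S.surjective y).choose
  have hσ : ∀ y ∈ W, σ y = t (s y) := fun y hy => if_pos hy
  refine ⟨⟨W, hW, σ, fun y => ?_, ?_, i, fun y hy => ?_⟩, ?_⟩
  · by_cases hy : y ∈ W
    · rw [hσ y hy, hζt _ hy.1.2, hps _ hy.1.1]
    · simp only [σ, if_neg hy]
      exact (S.surjective y).choose_spec
  · exact (hts.mono fun _ h => h.1).congr hσ
  · rw [hσ y hy]
    exact hy.2
  · refine ⟨⟨hxU, ?_⟩, ?_⟩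
    · change s x ∈ V
      rwa [hsx]
    · change t (s x) ∈ S.E.U i
      rwa [hsx, htz]

/-- The map `Z ×_M Z → Y ×_M Y`. -/
def ζ2 (p : S.Z2.mfd) : G.Y2.mfd := pt2 (S.ζ p.1.1) (S.ζ p.1.2) p.2

theorem smooth_ζ2 : Smooth S.ζ2 :=
  (G.Y2.smooth_iff S.Z2.mfd S.ζ2).2 ⟨S.ζ_submersion.smooth.comp S.Z2.smooth_fst,
    S.ζ_submersion.smooth.comp S.Z2.smooth_snd⟩

/-- The target of the isomorphism `α`. -/
abbrev tgt : BundleData S.Z2.mfd :=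
  (S.E.pullback (X' := S.Z2.mfd) (fun p => p.1.1)).tensor (G.L.pullback S.ζ2)

namespace LocalTriv

variable {S} (D D' : S.LocalTriv)

/-- The map to `Z ×_M Z` given by two sections of `Z → M`. -/
def pair (x : M) : S.Z2.mfd := ⟨(D.s x, D'.s x), (D.proj_s x).trans (D'.proj_s x).symm⟩

theorem smooth_pair : ContMDiffOn (𝓡 M.dim) (𝓡 S.Z2.mfd.dim) ∞ (D.pair D') (D.U ∩ D'.U) :=
  S.Z2.contMDiffOn (D.isOpen.inter D'.isOpen) (D.pair D') (D.smooth.mono fun _ h => h.1)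
    (D'.smooth.mono fun _ h => h.2)

/-- The rank of `E` does not depend on the local trivialisation, since `α` identifies the fibres
over a point of `M` up to tensoring with a line. -/
theorem card_eq {x : M} (hx : x ∈ D.U) (hx' : x ∈ D'.U) :
    Fintype.card (S.E.κ D'.i) = Fintype.card (S.E.κ D.i) := by
  obtain ⟨k, hk⟩ := G.hermitean.cover (S.ζ2 (D.pair D' x))
  have h1 : (S.E.pullback (X' := S.Z2.mfd) (fun p => p.1.2)).IsFrameAt D'.i (D.pair D' x) :=
    BundleData.IsFrameAt.pullback (S.hermitean.isFrameAt (D'.mem x hx'))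
  have h2 : S.tgt.IsFrameAt (D.i, k) (D.pair D' x) :=
    BundleData.IsFrameAt.tensor (BundleData.IsFrameAt.pullback (S.hermitean.isFrameAt (D.mem x hx)))
      (BundleData.IsFrameAt.pullback (G.hermitean.isFrameAt hk))
  have h3 := (S.α (D.pair D' x)).toLinearEquiv.finrank_eq
  have h4 := h1.finrank_eq.symm.trans (h3.trans h2.finrank_eq)
  refine h4.trans ((Fintype.card_prod _ _).trans ?_)
  change _ * Fintype.card (G.L.κ k) = _
  rw [G.card_frame hk, mul_one]
  rfl

/-- The comparison of the traces of the curvatures of two local trivialisations: they differ by the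
rank times the difference of the curvings. -/
theorem extDeriv_trConn_eq {T : Type*} [NormedAddCommGroup T] [NormedSpace ℝ T] {f : T → M}
    {W : Set T} (hW : IsOpen W) (hf : ContMDiffOn 𝓘(ℝ, T) (𝓡 M.dim) ∞ f W) {t : T} (ht : t ∈ W)
    (hft : f t ∈ D.U) (hft' : f t ∈ D'.U) :
    extDeriv ((S.E.trConn D'.i).pullE (D'.s ∘ f)) t =
      extDeriv ((S.E.trConn D.i).pullE (D.s ∘ f)) t + (Fintype.card (S.E.κ D.i) : ℝ) •
        ImR.incl.compContinuousAlternatingMap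
          (G.B.pullE (S.ζ ∘ D'.s ∘ f) t - G.B.pullE (S.ζ ∘ D.s ∘ f) t) := by
  obtain ⟨k, hk⟩ := G.hermitean.cover (S.ζ2 (D.pair D' (f t)))
  have : Unique (G.L.κ k) := (Fintype.card_eq_one_iff_nonempty_unique.1 (G.card_frame hk)).some
  have hW1 : IsOpen (W ∩ f ⁻¹' (D.U ∩ D'.U)) :=
    hf.continuousOn.isOpen_inter_preimage hW (D.isOpen.inter D'.isOpen)
  set g : T → S.Z2.mfd := D.pair D' ∘ f
  have hg1 : ContMDiffOn 𝓘(ℝ, T) (𝓡 S.Z2.mfd.dim) ∞ g (W ∩ f ⁻¹' (D.U ∩ D'.U)) :=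
    (D.smooth_pair D').comp (hf.mono fun _ h => h.1) fun _ h => h.2
  set W' := (W ∩ f ⁻¹' (D.U ∩ D'.U)) ∩ (S.ζ2 ∘ g) ⁻¹' G.L.U k
  have hW'o : IsOpen W' := (S.smooth_ζ2.continuous.comp_continuousOn
    hg1.continuousOn).isOpen_inter_preimage hW1 (G.hermitean.isOpen k)
  have htW' : t ∈ W' := ⟨⟨ht, hft, hft'⟩, hk⟩
  have hgW' : ContMDiffOn 𝓘(ℝ, T) (𝓡 S.Z2.mfd.dim) ∞ g W' := hg1.mono fun _ h => h.1
  have hgat : ∀ y ∈ W', ContMDiffAt 𝓘(ℝ, T) (𝓡 S.Z2.mfd.dim) ∞ g y := fun y hy =>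
    hgW'.contMDiffAt (hW'o.mem_nhds hy)
  have hgd : ∀ y ∈ W', MDifferentiableAt 𝓘(ℝ, T) (𝓡 S.Z2.mfd.dim) g y := fun y hy =>
    (hgat y hy).mdifferentiableAt (by simp)
  -- the trace of the connection of the source of `α`, pulled back along `g`
  have hsrc : ((S.E.pullback (X' := S.Z2.mfd) (fun p => p.1.2)).trConn D'.i).pullE g =ᶠ[𝓝 t]
      (S.E.trConn D'.i).pullE (D'.s ∘ f) := by
    filter_upwards [hW'o.mem_nhds htW'] with y hy
    rw [BundleData.trConn_pullback,
      DForm.pullE_pullback (hgd y hy) (S.Z2.smooth_snd.mdifferentiable (by simp) _)]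
    rfl
  -- the trace of the connection of the target of `α`, pulled back along `g`
  have htgt : (S.tgt.trConn (D.i, k)).pullE g =ᶠ[𝓝 t]
      (S.E.trConn D.i).pullE (D.s ∘ f) + (Fintype.card (S.E.κ D.i) : ℝ) •
        (G.L.conn k default default).pullE (S.ζ2 ∘ g) := by
    filter_upwards [hW'o.mem_nhds htW'] with y hy
    have h1 := @BundleData.trConn_tensor _ (S.E.pullback (X' := S.Z2.mfd) (fun p => p.1.1))
      (G.L.pullback S.ζ2) D.i k ‹Unique (G.L.κ k)›
    rw [BundleData.trConn_pullback] at h1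
    have h2 := DForm.pullE_pullback (hgd y hy) (S.Z2.smooth_fst.mdifferentiable (by simp) _)
      (S.E.trConn D.i)
    have h3 := DForm.pullE_pullback (hgd y hy) (S.smooth_ζ2.mdifferentiable (by simp) _)
      (G.L.conn k default default)
    rw [Pi.add_apply, Pi.smul_apply, ← h3]
    refine Eq.trans ?_ (congrArg₂ (· + ·) h2 rfl)
    exact (congrArg (fun w => DForm.pullE g w y) h1).trans rfl
  have hsm1 : ContDiffAt ℝ ∞ ((S.E.trConn D.i).pullE (D.s ∘ f)) t :=
    DForm.contDiffAt_pullE ((D.smooth.contMDiffAt (D.isOpen.mem_nhds hft)).comp t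
      (hf.contMDiffAt (hW.mem_nhds ht))) (S.hermitean.trConn_smooth D.i) (D.mem _ hft)
  have hζg : ContMDiffAt 𝓘(ℝ, T) (𝓡 G.Y2.mfd.dim) ∞ (S.ζ2 ∘ g) t :=
    S.smooth_ζ2.contMDiffAt.comp t (hgat t htW')
  have hsm2 : ContDiffAt ℝ ∞ ((G.L.conn k default default).pullE (S.ζ2 ∘ g)) t :=
    DForm.contDiffAt_pullE hζg (G.hermitean.conn_smooth k default default) hk
  have hd1 := hsm1.differentiableAt (by simp)
  have hd2 : DifferentiableAt ℝ ((Fintype.card (S.E.κ D.i) : ℝ) •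
      (G.L.conn k default default).pullE (S.ζ2 ∘ g)) t :=
    (hsm2.const_smul (Fintype.card (S.E.κ D.i) : ℝ)).differentiableAt (by simp)
  have main := S.α_parallel.extDeriv_trConn_eq (i := D'.i) (j := (D.i, k)) hW'o hgW'
    (((S.hermitean.isOpen D'.i).preimage S.Z2.smooth_snd.continuous).inter
      (((S.hermitean.isOpen D.i).preimage S.Z2.smooth_fst.continuous).inter
        ((G.hermitean.isOpen k).preimage S.smooth_ζ2.continuous)))
    (fun y hy => ⟨D'.mem _ hy.1.2.2, D.mem _ hy.1.2.1, hy.2⟩)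
    (fun y hy => BundleData.IsFrameAt.pullback (S.hermitean.isFrameAt (D'.mem _ hy.1.2.2)))
    (fun y hy => BundleData.IsFrameAt.tensor
      (BundleData.IsFrameAt.pullback (S.hermitean.isFrameAt (D.mem _ hy.1.2.1)))
      (BundleData.IsFrameAt.pullback (G.hermitean.isFrameAt hy.2)))
    htW' ((hd1.add hd2).congr_of_eventuallyEq htgt)
  rw [hsrc.extDeriv_eq] at main
  refine main.trans (htgt.extDeriv_eq.trans ?_)
  rw [extDeriv_add hd1 hd2, extDeriv_smul,
    DForm.extDeriv_pullE hζg (G.hermitean.conn_smooth k default default) hk]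
  congr 2
  have h4 := DForm.pullE_pullback (hζg.mdifferentiableAt (by simp))
    (G.Y2.smooth_snd.mdifferentiable (by simp) _) G.B
  have h5 := DForm.pullE_pullback (hζg.mdifferentiableAt (by simp))
    (G.Y2.smooth_fst.mdifferentiable (by simp) _) G.B
  have h6 := G.B_curv k default _ hk
  change ((G.L.conn k default default).d (S.ζ2 (D.pair D' (f t)))).compContinuousLinearMap _ = _
  rw [← h6]
  refine Eq.trans ?_ (congrArg _ (congrArg₂ (· - ·) h4 h5))
  rfl

end LocalTriv

end Section

end BundleGerbe

/-! ### The rank of a section and the primitive of the curvature -/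

section ImaginaryForms

/-- The projection `ℂ → iℝ` along the real axis. -/
def ImR.proj : ℂ →L[ℝ] ImR :=
  (Complex.imCLM.smulRight Complex.I).codRestrict (skewAdjoint.submodule ℝ ℂ) fun z => by
    change star ((z.im : ℝ) • Complex.I) = -((z.im : ℝ) • Complex.I)
    simp

theorem ImR.proj_incl (z : ImR) : ImR.proj (ImR.incl z) = z := by
  have h : star (z : ℂ) = -(z : ℂ) := z.2
  have hre : (z : ℂ).re = 0 := by
    have := congrArg Complex.re h
    simp at this
    linarith
  apply Subtype.ext
  apply Complex.ext
  · simpa [ImR.proj] using hre.symm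
  · simp [ImR.proj]

variable {E : Type*} [NormedAddCommGroup E] [NormedSpace ℝ E] {k : ℕ}
  {V W : Type*} [NormedAddCommGroup V] [NormedSpace ℝ V] [NormedAddCommGroup W] [NormedSpace ℝ W]

theorem extDeriv_clm_comp (L : V →L[ℝ] W) {w : E → E [⋀^Fin k]→L[ℝ] V} {e : E}
    (h : DifferentiableAt ℝ w e) :
    extDeriv (fun y => L.compContinuousAlternatingMap (w y)) e =
      L.compContinuousAlternatingMap (extDeriv w e) := by
  have h1 : HasFDerivAt (fun y => L.compContinuousAlternatingMap (w y)) _ e :=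
    (ContinuousLinearMap.compContinuousAlternatingMapCLM ℝ E V W (Fin k) L).hasFDerivAt.comp e
      h.hasFDerivAt
  ext v
  simp [extDeriv, h1.fderiv, ContinuousAlternatingMap.alternatizeUncurryFin_apply]

theorem contDiffAt_clm_comp (L : V →L[ℝ] W) {w : E → E [⋀^Fin k]→L[ℝ] V} {e : E} {n : ℕ∞ω}
    (h : ContDiffAt ℝ n w e) :
    ContDiffAt ℝ n (fun y => L.compContinuousAlternatingMap (w y)) e :=
  (ContinuousLinearMap.compContinuousAlternatingMapCLM ℝ E V W (Fin k) L).contDiff.contDiffAt.comp e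
    h

theorem contDiffAt_extDeriv {w : E → E [⋀^Fin k]→L[ℝ] V} {e : E} (h : ContDiffAt ℝ ∞ w e) :
    ContDiffAt ℝ ∞ (extDeriv w) e :=
  (ContinuousAlternatingMap.alternatizeUncurryFinCLM ℝ E V).contDiff.contDiffAt.comp e
    (h.fderiv_right le_rfl)

end ImaginaryForms

namespace BundleGerbe.Section

variable {M : Mfd.{u}} {G : BundleGerbe M} (S : G.Section)

section Rank

/-- A chosen local trivialisation at a point. -/
def triv (x : M) : S.LocalTriv := (S.exists_localTriv x).choose

theorem mem_triv (x : M) : x ∈ (S.triv x).U := (S.exists_localTriv x).choose_spec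

/-- The rank of the bundle of a section, as a function on `M`. -/
def rank (x : M) : ℕ := Fintype.card (S.E.κ (S.triv x).i)

theorem rank_eq (D : S.LocalTriv) {x : M} (hx : x ∈ D.U) :
    S.rank x = Fintype.card (S.E.κ D.i) :=
  D.card_eq (S.triv x) hx (S.mem_triv x)

theorem isLocallyConstant_rank : IsLocallyConstant S.rank :=
  (IsLocallyConstant.iff_exists_open _).2 fun x => ⟨_, (S.triv x).isOpen, S.mem_triv x,
    fun _ hy => S.rank_eq _ hy⟩

theorem finrank_fiber (z : S.Z) : Module.finrank ℂ (S.E.fiber z) = S.rank (G.proj (S.ζ z)) := by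
  set x := G.proj (S.ζ z)
  let p : S.Z2.mfd := ⟨((S.triv x).s x, z), (S.triv x).proj_s x⟩
  have h := (S.α p).toLinearEquiv.finrank_eq
  change Module.finrank ℂ (S.E.fiber z) =
    Module.finrank ℂ (S.E.fiber ((S.triv x).s x) ⊗[ℂ] G.L.fiber (S.ζ2 p)) at h
  rw [h, Module.finrank_tensorProduct, G.line, mul_one]
  exact (S.hermitean.isFrameAt ((S.triv x).mem x (S.mem_triv x))).finrank_eq

theorem subsingleton_fiber_iff (z : S.Z) :
    Subsingleton (S.E.fiber z) ↔ S.rank (G.proj (S.ζ z)) = 0 := by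
  obtain ⟨i, hi⟩ := S.hermitean.cover z
  have : FiniteDimensional ℂ (S.E.fiber z) :=
    (S.hermitean.isFrameAt hi).basis.toBasis.finiteDimensional_of_finite
  rw [← finrank_fiber, Module.finrank_zero_iff]

theorem vanishesOver_of_rank_eq_zero {x : M} (hx : S.rank x = 0) :
    S.VanishesOver (connectedComponent x) := fun z hz => by
  rw [subsingleton_fiber_iff, ← hx]
  exact S.isLocallyConstant_rank.apply_eq_of_isPreconnected isPreconnected_connectedComponent hz
    mem_connectedComponent

end Rank

section Primitive

/-- The contribution `r⁻¹ tr F - B` of a local trivialisation of `E` of rank `r` to the primitive of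
the curvature of the gerbe. The form `tr F` is projected to `iℝ`. -/
def LocalTriv.primitive {S : G.Section} (D : S.LocalTriv) : DForm M 2 ImR := fun x =>
  ((Fintype.card (S.E.κ D.i) : ℝ)⁻¹ • ImR.proj).compContinuousAlternatingMap
    ((S.E.trConn D.i).d.pullback D.s x) - G.B.pullback (S.ζ ∘ D.s) x

variable {S}

theorem LocalTriv.pullE_primitive (D : S.LocalTriv) {T : Type*} [NormedAddCommGroup T]
    [NormedSpace ℝ T] {f : T → M} {t : T} (hf : ContMDiffAt 𝓘(ℝ, T) (𝓡 M.dim) ∞ f t)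
    (hft : f t ∈ D.U) :
    D.primitive.pullE f t =
      ((Fintype.card (S.E.κ D.i) : ℝ)⁻¹ • ImR.proj).compContinuousAlternatingMap
        (extDeriv ((S.E.trConn D.i).pullE (D.s ∘ f)) t) - G.B.pullE (S.ζ ∘ D.s ∘ f) t := by
  have hs := D.smooth.contMDiffAt (D.isOpen.mem_nhds hft)
  have hζs : ContMDiffAt (𝓡 M.dim) (𝓡 G.Y.dim) ∞ (S.ζ ∘ D.s) (f t) :=
    S.ζ_submersion.smooth.contMDiffAt.comp _ hs
  rw [DForm.extDeriv_pullE (hs.comp t hf) (S.hermitean.trConn_smooth D.i) (D.mem _ hft),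
    ← DForm.pullE_pullback (hf.mdifferentiableAt (by simp)) (hs.mdifferentiableAt (by simp)),
    show S.ζ ∘ D.s ∘ f = (S.ζ ∘ D.s) ∘ f from rfl,
    ← DForm.pullE_pullback (hf.mdifferentiableAt (by simp)) (hζs.mdifferentiableAt (by simp))]
  rfl

/-- Where the rank is non-zero, the form `r⁻¹ tr F - B` does not depend on the local trivialisation.
-/
theorem LocalTriv.primitive_eq (D D' : S.LocalTriv) {x : M} (hx : x ∈ D.U) (hx' : x ∈ D'.U)
    (hr : S.rank x ≠ 0) : D'.primitive x = D.primitive x := by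
  rw [D.primitive.apply_eq_of_inChart x, D'.primitive.apply_eq_of_inChart x]
  congr 1
  set ψ := chartAt (EuclideanSpace ℝ (Fin M.dim)) x
  have hxs : x ∈ ψ.source := mem_chart_source _ _
  have hψx : ψ.symm (ψ x) = x := ψ.left_inv hxs
  have hφ : ContMDiffOn 𝓘(ℝ, EuclideanSpace ℝ (Fin M.dim)) (𝓡 M.dim) ∞ ψ.symm ψ.target :=
    contMDiffOn_chart_symm (n := ∞)
  have hφ' := hφ.contMDiffAt (ψ.open_target.mem_nhds (ψ.map_source hxs))
  rw [DForm.inChart_eq_pullE, DForm.inChart_eq_pullE,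
    D.pullE_primitive hφ' (by rwa [hψx]), D'.pullE_primitive hφ' (by rwa [hψx]),
    D.extDeriv_trConn_eq D' ψ.open_target hφ (ψ.map_source hxs) (by rwa [hψx]) (by rwa [hψx]),
    ← S.rank_eq D hx, ← S.rank_eq D' hx']
  have hr' : (S.rank x : ℝ) ≠ 0 := by exact_mod_cast hr
  ext1 v
  simp only [ContinuousAlternatingMap.sub_apply, ContinuousAlternatingMap.add_apply,
    ContinuousLinearMap.compContinuousAlternatingMap_coe, Function.comp_apply, map_add, map_smul,
    ContinuousAlternatingMap.smul_apply, smul_apply, ImR.proj_incl, map_sub]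
  rw [smul_sub, smul_inv_smul₀ hr', smul_inv_smul₀ hr']
  abel

/-- If the rank of a section vanishes nowhere, the local forms `r⁻¹ tr F - B` glue to a primitive of
minus the curvature. -/
theorem mem_exactForms_of_rank_ne_zero {H : DForm M 3 ImR} (hH : G.IsCurvature H)
    (hr : ∀ x, S.rank x ≠ 0) : H ∈ exactForms M 2 ImR := by
  let ρ : DForm M 2 ImR := fun x => (S.triv x).primitive x
  have hρ : ∀ x₀, ∀ y ∈ (S.triv x₀).U, ρ y = (S.triv x₀).primitive y := fun x₀ y hy =>
    LocalTriv.primitive_eq _ _ hy (S.mem_triv y) (hr y)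
  -- near `x`, `ρ` is given by the single local trivialisation chosen at `x`
  have hloc : ∀ x, (ρ.inChart x =ᶠ[𝓝 (chartAt (EuclideanSpace ℝ (Fin M.dim)) x x)] fun e =>
      ((Fintype.card (S.E.κ (S.triv x).i) : ℝ)⁻¹ • ImR.proj).compContinuousAlternatingMap
        (extDeriv ((S.E.trConn (S.triv x).i).pullE ((S.triv x).s ∘
          (chartAt (EuclideanSpace ℝ (Fin M.dim)) x).symm)) e) -
          G.B.pullE (S.ζ ∘ (S.triv x).s ∘ (chartAt (EuclideanSpace ℝ (Fin M.dim)) x).symm) e) ∧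
      ContDiffAt ℝ ∞ ((S.E.trConn (S.triv x).i).pullE ((S.triv x).s ∘
        (chartAt (EuclideanSpace ℝ (Fin M.dim)) x).symm))
        (chartAt (EuclideanSpace ℝ (Fin M.dim)) x x) ∧
      ContMDiffAt 𝓘(ℝ, EuclideanSpace ℝ (Fin M.dim)) (𝓡 G.Y.dim) ∞
        (S.ζ ∘ (S.triv x).s ∘ (chartAt (EuclideanSpace ℝ (Fin M.dim)) x).symm)
        (chartAt (EuclideanSpace ℝ (Fin M.dim)) x x) ∧
      ∀ᶠ e in 𝓝 (chartAt (EuclideanSpace ℝ (Fin M.dim)) x x), ContMDiffAt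
        𝓘(ℝ, EuclideanSpace ℝ (Fin M.dim)) (𝓡 G.Y.dim) ∞
        (S.ζ ∘ (S.triv x).s ∘ (chartAt (EuclideanSpace ℝ (Fin M.dim)) x).symm) e := by
    intro x
    set ψ := chartAt (EuclideanSpace ℝ (Fin M.dim)) x with hψ
    set D := S.triv x
    have hxs : x ∈ ψ.source := mem_chart_source _ _
    have hψx : ψ.symm (ψ x) = x := ψ.left_inv hxs
    have hW : IsOpen (ψ.target ∩ ψ.symm ⁻¹' D.U) := ψ.symm.isOpen_inter_preimage D.isOpen
    have hxW : ψ x ∈ ψ.target ∩ ψ.symm ⁻¹' D.U :=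
      ⟨ψ.map_source hxs, by simpa [hψx] using S.mem_triv x⟩
    have hφ : ContMDiffOn 𝓘(ℝ, EuclideanSpace ℝ (Fin M.dim)) (𝓡 M.dim) ∞ ψ.symm
        (ψ.target ∩ ψ.symm ⁻¹' D.U) := (contMDiffOn_chart_symm (n := ∞)).mono fun _ h => h.1
    have hsφ : ContMDiffOn 𝓘(ℝ, EuclideanSpace ℝ (Fin M.dim)) (𝓡 S.Z.dim) ∞ (D.s ∘ ψ.symm)
        (ψ.target ∩ ψ.symm ⁻¹' D.U) := D.smooth.comp hφ fun _ h => h.2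
    have hζ : ∀ e ∈ ψ.target ∩ ψ.symm ⁻¹' D.U,
        ContMDiffAt 𝓘(ℝ, EuclideanSpace ℝ (Fin M.dim)) (𝓡 G.Y.dim) ∞ (S.ζ ∘ D.s ∘ ψ.symm) e :=
      fun e he => S.ζ_submersion.smooth.contMDiffAt.comp e (hsφ.contMDiffAt (hW.mem_nhds he))
    refine ⟨?_, DForm.contDiffAt_pullE (hsφ.contMDiffAt (hW.mem_nhds hxW))
      (S.hermitean.trConn_smooth D.i) (D.mem _ hxW.2), hζ _ hxW,
      Filter.Eventually.mono (hW.mem_nhds hxW) hζ⟩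
    filter_upwards [hW.mem_nhds hxW] with e he
    rw [← D.pullE_primitive (hφ.contMDiffAt (hW.mem_nhds he)) he.2]
    change (ρ _).compContinuousLinearMap _ = _
    rw [hρ x _ he.2]
    rfl
  have hsm : ρ.SmoothOn Set.univ := fun x _ => by
    obtain ⟨h1, h2, h3, -⟩ := hloc x
    refine ContDiffAt.congr_of_eventuallyEq ?_ h1
    exact (contDiffAt_clm_comp _ (contDiffAt_extDeriv h2)).sub
      (DForm.contDiffAt_pullE h3 G.B_smooth trivial)
  have hd : ρ.d = (-1 : ℝ) • H := by
    funext x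
    obtain ⟨h1, h2, h3, h4⟩ := hloc x
    set ψ := chartAt (EuclideanSpace ℝ (Fin M.dim)) x with hψ
    have hxs : x ∈ ψ.source := mem_chart_source _ _
    have hψx : ψ.symm (ψ x) = x := ψ.left_inv hxs
    have key : extDeriv (ρ.inChart x) (ψ x) = (-1 : ℝ) • H.inChart x (ψ x) := by
      rw [h1.extDeriv_eq]
      have h5 : DifferentiableAt ℝ (extDeriv ((S.E.trConn (S.triv x).i).pullE ((S.triv x).s ∘
          ψ.symm))) (ψ x) := (contDiffAt_extDeriv h2).differentiableAt (by simp)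
      have h6 := (DForm.contDiffAt_pullE h3 G.B_smooth trivial).const_smul (-1 : ℝ)
      have h6' : DifferentiableAt ℝ ((-1 : ℝ) • G.B.pullE (S.ζ ∘ (S.triv x).s ∘ ψ.symm)) (ψ x) :=
        h6.differentiableAt (by simp)
      have h7 := extDeriv_add
        ((contDiffAt_clm_comp ((Fintype.card (S.E.κ (S.triv x).i) : ℝ)⁻¹ • ImR.proj)
          (contDiffAt_extDeriv h2)).differentiableAt (by simp)) h6'
      have h8 : extDeriv (G.B.pullE (S.ζ ∘ (S.triv x).s ∘ ψ.symm)) (ψ x) = H.inChart x (ψ x) := by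
        rw [DForm.extDeriv_pullE h3 G.B_smooth trivial, ← hH.pullback,
          DForm.pullE_pullback (h3.mdifferentiableAt (by simp))
            (G.proj_submersion.smooth.mdifferentiable (by simp) _)]
        refine DForm.pullE_congr (Filter.Eventually.of_forall fun e => ?_) H
        exact (S.triv x).proj_s _
      rw [extDeriv_clm_comp _ h5, extDeriv_extDeriv_apply h2 minSmoothness_two_le] at h7
      have h9 := extDeriv_smul (x := ψ x) (-1 : ℝ) (G.B.pullE (S.ζ ∘ (S.triv x).s ∘ ψ.symm))
      rw [h8] at h9
      refine Eq.trans ?_ (h7.trans ?_)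
      · congr 1
        funext e
        simp [sub_eq_add_neg]
      · refine (congrArg₂ (· + ·) ?_ h9).trans (zero_add _)
        ext v
        simp
    change (extDeriv (ρ.inChart x) (ψ x)).compContinuousLinearMap _ = (-1 : ℝ) • H x
    rw [key, H.apply_eq_of_inChart x]
    rfl
  refine ⟨(-1 : ℝ) • ρ, hsm.smul _, ?_⟩
  rw [DForm.d_smul, hd, smul_smul]
  norm_num

end Primitive

/-- A section of a gerbe whose curvature is not exact vanishes over a component. -/
theorem exists_vanishesOver {H : DForm M 3 ImR} (hH : G.IsCurvature H)
    (hne : deRhamClass ⟨H, hH.mem_closedForms⟩ ≠ 0) :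
    ∃ x : M, S.VanishesOver (connectedComponent x) := by
  by_contra hcon
  refine hne ((Submodule.Quotient.mk_eq_zero _).2 ?_)
  exact Section.mem_exactForms_of_rank_ne_zero hH fun x hx =>
    hcon ⟨x, S.vanishesOver_of_rank_eq_zero hx⟩

end BundleGerbe.Section

/-! ### Refinement of covers and local logarithms -/

section Refinement

/-- Refinement of an open cover of a paracompact space for a local property of triples of members:
there is a refinement such that the property holds on all non-empty triple intersections. The
members of a locally finite refinement are shrunk; the neighbourhood of a point avoids those
closures of shrunk members that do not contain it, and only finitely many triples are left. -/
theorem exists_refinement {X A : Type*} [TopologicalSpace X] [T2Space X] [ParacompactSpace X]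
    {V : A → Set X} (hV : ∀ a, IsOpen (V a)) (hcov : ∀ x, ∃ a, x ∈ V a)
    {P : A → A → A → Set X → Prop}
    (hmono : ∀ a b c U U', U ⊆ U' → P a b c U' → P a b c U)
    (hloc : ∀ a b c, ∀ x ∈ V a ∩ V b ∩ V c, ∃ U, IsOpen U ∧ x ∈ U ∧ P a b c U) :
    ∃ (τ : X → A) (U : X → Set X), (∀ x, IsOpen (U x)) ∧ (∀ x, x ∈ U x) ∧
      (∀ x, U x ⊆ V (τ x)) ∧
      ∀ x y z, (U x ∩ U y ∩ U z).Nonempty → P (τ x) (τ y) (τ z) (U x ∩ U y ∩ U z) := by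
  obtain ⟨V', hV'o, hV'c, hV'f, hV'V⟩ := precise_refinement V hV (Set.iUnion_eq_univ_iff.2 hcov)
  obtain ⟨W, hWc, hWo, hWV⟩ := exists_iUnion_eq_closure_subset hV'o
    (fun x => hV'f.point_finite x) hV'c
  have hWf : LocallyFinite fun a => closure (W a) := hV'f.subset hWV
  choose τ hτ using Set.iUnion_eq_univ_iff.1 hWc
  have hne : ∀ x, ∃ U, IsOpen U ∧ x ∈ U ∧ U ⊆ W (τ x) ∧
      (∀ a, (U ∩ W a).Nonempty → x ∈ closure (W a)) ∧
      ∀ a b c, x ∈ closure (W a) → x ∈ closure (W b) → x ∈ closure (W c) → P a b c U := by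
    intro x
    have hfin : {a | x ∈ closure (W a)}.Finite := hWf.point_finite x
    have hsub : ∀ a, x ∈ closure (W a) → x ∈ V a := fun a ha => hV'V a (hWV a ha)
    have h3 : ∀ a b c, ∃ U, U ∈ 𝓝 x ∧
        (x ∈ closure (W a) → x ∈ closure (W b) → x ∈ closure (W c) → P a b c U) := by
      intro a b c
      by_cases h : x ∈ closure (W a) ∧ x ∈ closure (W b) ∧ x ∈ closure (W c)
      · obtain ⟨U, hU, hxU, hP⟩ := hloc a b c x ⟨⟨hsub a h.1, hsub b h.2.1⟩, hsub c h.2.2⟩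
        exact ⟨U, hU.mem_nhds hxU, fun _ _ _ => hP⟩
      · exact ⟨Set.univ, Filter.univ_mem, fun h1 h2 h3 => absurd ⟨h1, h2, h3⟩ h⟩
    choose N hN hNP using h3
    have hN' : (⋂ a ∈ {a | x ∈ closure (W a)}, ⋂ b ∈ {a | x ∈ closure (W a)},
        ⋂ c ∈ {a | x ∈ closure (W a)}, N a b c) ∈ 𝓝 x :=
      (Filter.biInter_mem hfin).2 fun a _ => (Filter.biInter_mem hfin).2 fun b _ =>
        (Filter.biInter_mem hfin).2 fun c _ => hN a b c
    have h2 := hWf.iInter_compl_mem_nhds (fun a => isClosed_closure) x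
    obtain ⟨U, hU, hUo, hxU⟩ := mem_nhds_iff.1 (Filter.inter_mem ((hWo _).mem_nhds (hτ x))
      (Filter.inter_mem h2 hN'))
    refine ⟨U, hUo, hxU, fun y hy => (hU hy).1, ?_, ?_⟩
    · rintro a ⟨y, hyU, hyW⟩
      by_contra hx
      have := (hU hyU).2.1
      simp only [Set.mem_iInter] at this
      exact this a hx (subset_closure hyW)
    · intro a b c ha hb hc
      refine hmono a b c U _ (fun y hy => ?_) (hNP a b c ha hb hc)
      have := (hU hy).2.2
      simp only [Set.mem_iInter] at this
      exact this a ha b hb c hc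
  choose U hUo hxU hUW hUc hUP using hne
  refine ⟨τ, U, hUo, hxU, fun x y hy => hV'V _ (hWV _ (subset_closure (hUW x hy))), ?_⟩
  rintro x y z ⟨p, ⟨hpx, hpy⟩, hpz⟩
  exact hmono _ _ _ _ (U x) (fun q hq => hq.1.1)
    (hUP x _ _ _ (hUc x _ ⟨p, hpx, hUW x hpx⟩) (hUc x _ ⟨p, hpx, hUW y hpy⟩)
      (hUc x _ ⟨p, hpx, hUW z hpz⟩))

instance (M : Mfd.{u}) : ParacompactSpace M := by
  have : LocallyCompactSpace M :=
    ChartedSpace.locallyCompactSpace (EuclideanSpace ℝ (Fin M.dim)) M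
  infer_instance

end Refinement

section Logarithms

open Complex

/-- A branch of the logarithm near `g x`: the quotient `g y / g x` is close to `1`, hence in the
slit plane. -/
theorem exists_local_log {X : Type*} [TopologicalSpace X] {U : Set X} (hU : IsOpen U) {g : X → ℂ}
    (hg : ContinuousOn g U) {x : X} (hx : x ∈ U) (hgx : g x ≠ 0) :
    ∃ W, IsOpen W ∧ x ∈ W ∧ W ⊆ U ∧ (∀ y ∈ W, g y / g x ∈ slitPlane) ∧
      ∀ y ∈ W, exp (log (g y / g x) + log (g x)) = g y := by
  have hc : ContinuousOn (fun y => g y / g x) U := hg.div_const _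
  refine ⟨U ∩ (fun y => g y / g x) ⁻¹' slitPlane, hc.isOpen_inter_preimage hU isOpen_slitPlane,
    ⟨hx, by simp [div_self hgx]⟩, fun y hy => hy.1, fun y hy => hy.2, fun y hy => ?_⟩
  rw [exp_add, exp_log (slitPlane_ne_zero hy.2), exp_log hgx, div_mul_cancel₀ _ hgx]

theorem exists_continuous_log {X : Type*} [TopologicalSpace X] {U : Set X} (hU : IsOpen U)
    {g : X → ℂ} (hg : ContinuousOn g U) {x : X} (hx : x ∈ U) (hgx : g x ≠ 0) :
    ∃ W, IsOpen W ∧ x ∈ W ∧ ∃ ψ : X → ℂ, ContinuousOn ψ W ∧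
      ∀ y ∈ W, g y = exp (2 * Real.pi * I * ψ y) := by
  obtain ⟨W, hW, hxW, hWU, hs, he⟩ := exists_local_log hU hg hx hgx
  refine ⟨W, hW, hxW, fun y => (log (g y / g x) + log (g x)) / (2 * Real.pi * I), ?_,
    fun y hy => ?_⟩
  · exact ((((hg.mono hWU).div_const _).clog hs).add continuousOn_const).div_const _
  · rw [mul_div_cancel₀ _ two_pi_I_ne_zero, he y hy]

theorem exists_smooth_log {X : Mfd.{u}} {U : Set X} (hU : IsOpen U) {g : X → ℂ}
    (hg : SmoothFunOn g U) (h1 : ∀ y ∈ U, ‖g y‖ = 1) {x : X} (hx : x ∈ U) :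
    ∃ W, IsOpen W ∧ x ∈ W ∧ ∃ θ : X → ℝ, SmoothFunOn θ W ∧
      ∀ y ∈ W, g y = exp (2 * Real.pi * I * (θ y : ℂ)) := by
  have hgx : g x ≠ 0 := fun h => by simpa [h] using h1 x hx
  obtain ⟨W, hW, hxW, hWU, hs, he⟩ := exists_local_log hU hg.continuousOn hx hgx
  refine ⟨W, hW, hxW, fun y => (log (g y / g x) + log (g x)).im / (2 * Real.pi), ?_,
    fun y hy => ?_⟩
  · intro y hy
    have h2 : ContDiffAt ℝ ∞
        (fun w : ℂ => (log (w / g x) + log (g x)).im / (2 * Real.pi)) (g y) := by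
      have h3 : ContDiffAt ℝ ∞ (fun w : ℂ => log (w / g x)) (g y) :=
        ((contDiffAt_log (hs y hy)).restrict_scalars ℝ).comp (g y)
          (contDiff_id.div_const _).contDiffAt
      exact (imCLM.contDiff.contDiffAt.comp _ (h3.add contDiffAt_const)).div_const _
    exact h2.contMDiffAt.comp_contMDiffWithinAt y ((hg y (hWU hy)).mono hWU)
  · set L := log (g y / g x) + log (g x) with hL
    have hre : L.re = 0 := by
      have := h1 y (hWU hy)
      rw [← he y hy, norm_exp] at this
      exact Real.exp_eq_one_iff _ |>.1 this
    have h3 : (2 * Real.pi * I * ((L.im / (2 * Real.pi) : ℝ) : ℂ)) = L := by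
      have hpi : (Real.pi : ℂ) ≠ 0 := by exact_mod_cast Real.pi_ne_zero
      push_cast
      apply Eq.trans (b := (L.im : ℂ) * I)
      · field_simp
      · conv_rhs => rw [← re_add_im L, hre]
        simp
    rw [h3, he y hy]

theorem exists_int_of_exp_eq_one {z : ℂ} (h : exp (2 * Real.pi * I * z) = 1) : ∃ n : ℤ, z = n := by
  obtain ⟨n, hn⟩ := exp_eq_one_iff.1 h
  refine ⟨n, mul_left_cancel₀ two_pi_I_ne_zero ?_⟩
  rw [hn, mul_comm]

end Logarithms

/-! ### A section of constant rank in local frames -/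

/-- Associativity of `μ`, with the reassociation of tensors evaluated. -/
theorem BundleGerbe.mul_mul {M : Mfd.{u}} (G : BundleGerbe M) {a b c e : G.Y}
    (hab : G.proj a = G.proj b) (hbc : G.proj b = G.proj c) (hce : G.proj c = G.proj e)
    (x : G.L.fiber (pt2 a b hab)) (y : G.L.fiber (pt2 b c hbc)) (z : G.L.fiber (pt2 c e hce)) :
    G.mul a c e (hab.trans hbc) hce (G.mul a b c hab hbc (x ⊗ₜ[ℂ] y) ⊗ₜ[ℂ] z) =
      G.mul a b e hab (hbc.trans hce) (x ⊗ₜ[ℂ] G.mul b c e hbc hce (y ⊗ₜ[ℂ] z)) :=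
  G.assoc a b c e hab hbc hce x y z

namespace BundleGerbe.Section

variable {M : Mfd.{u}} {G : BundleGerbe M}

/-- An open cover of `M` over which a section of constant rank `r` is trivialised: local sections of
`Z → M` and orthonormal frames of `E` over the members, and unitary frames of `L`, each with a
single element, over the double intersections. A single frame of `L` on each double intersection
replaces the requirement that the cover be good; on empty intersections its choice is irrelevant. -/
structure TrivCover (S : G.Section) (r : ℕ) where
  D : M → S.LocalTriv
  cover : ∀ x, ∃ a, x ∈ (D a).U
  e : ∀ a, Fin r ≃ S.E.κ (D a).i
  k : M → M → G.L.ι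
  k_unique : ∀ a b, Unique (G.L.κ (k a b))
  mem_k : ∀ a b, ∀ x ∈ (D a).U ∩ (D b).U, S.ζ2 ((D a).pair (D b) x) ∈ G.L.U (k a b)

theorem exists_trivCover (S : G.Section) {r : ℕ} (hr : ∀ x, S.rank x = r) :
    Nonempty (S.TrivCover r) := by
  obtain ⟨τ, U, hU, hxU, hUτ, hP⟩ := exists_refinement (fun x => (S.triv x).isOpen)
    (fun x => ⟨x, S.mem_triv x⟩)
    (P := fun a b _ U => ∃ k, ∀ x ∈ U, S.ζ2 ((S.triv a).pair (S.triv b) x) ∈ G.L.U k)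
    (fun a b c U U' hUU' ⟨k, hk⟩ => ⟨k, fun x hx => hk x (hUU' hx)⟩)
    (fun a b c x hx => by
      obtain ⟨k, hk⟩ := G.hermitean.cover (S.ζ2 ((S.triv a).pair (S.triv b) x))
      have hc : ContinuousOn (fun x => S.ζ2 ((S.triv a).pair (S.triv b) x))
          ((S.triv a).U ∩ (S.triv b).U) :=
        S.smooth_ζ2.continuous.comp_continuousOn ((S.triv a).smooth_pair (S.triv b)).continuousOn
      exact ⟨_, hc.isOpen_inter_preimage ((S.triv a).isOpen.inter (S.triv b).isOpen)
        (G.hermitean.isOpen k), ⟨hx.1, hk⟩, k, fun y hy => hy.2⟩)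
  have hk : ∀ a b, ∃ k, Fintype.card (G.L.κ k) = 1 ∧
      ∀ x ∈ U a ∩ U b, S.ζ2 ((S.triv (τ a)).pair (S.triv (τ b)) x) ∈ G.L.U k := by
    intro a b
    by_cases hab : (U a ∩ U b).Nonempty
    · obtain ⟨x, hx⟩ := hab
      obtain ⟨k, hk⟩ := hP a b b ⟨x, hx, hx.2⟩
      exact ⟨k, G.card_frame (hk x ⟨hx, hx.2⟩), fun y hy => hk y ⟨hy, hy.2⟩⟩
    · obtain ⟨k, hk⟩ := G.hermitean.cover (S.ζ2 ((S.triv a).pair (S.triv a) a))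
      exact ⟨k, G.card_frame hk, fun y hy => absurd ⟨y, hy⟩ hab⟩
  choose k hk1 hk2 using hk
  exact ⟨{
    D := fun a =>
      { U := U a
        isOpen := hU a
        s := (S.triv (τ a)).s
        proj_s := (S.triv (τ a)).proj_s
        smooth := (S.triv (τ a)).smooth.mono (hUτ a)
        i := (S.triv (τ a)).i
        mem := fun x hx => (S.triv (τ a)).mem x (hUτ a hx) }
    cover := fun x => ⟨x, hxU x⟩
    e := fun a => (finCongr (by
      rw [← hr a, S.rank_eq _ (hUτ a (hxU a))])).trans (Fintype.equivFin _).symm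
    k := k
    k_unique := fun a b => (Fintype.card_eq_one_iff_nonempty_unique.1 (hk1 a b)).some
    mem_k := hk2 }⟩

namespace TrivCover

variable {S : G.Section} {r : ℕ} (C : S.TrivCover r)

attribute [instance] TrivCover.k_unique

/-- The local sections of `Y → M`. -/
def y (a x : M) : G.Y := S.ζ ((C.D a).s x)

theorem proj_y (a x : M) : G.proj (C.y a x) = x := (C.D a).proj_s x

theorem proj_eq (a b x : M) : G.proj (C.y a x) = G.proj (C.y b x) :=
  (C.proj_y a x).trans (C.proj_y b x).symm

theorem smooth_y (a : M) : ContMDiffOn (𝓡 M.dim) (𝓡 G.Y.dim) ∞ (C.y a) (C.D a).U :=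
  S.ζ_submersion.smooth.comp_contMDiffOn (C.D a).smooth

/-- The map to `Y ×_M Y` given by two local sections. -/
def pairY (a b x : M) : G.Y2.mfd := pt2 (C.y a x) (C.y b x) (C.proj_eq a b x)

theorem smooth_pairY (a b : M) : ContMDiffOn (𝓡 M.dim) (𝓡 G.Y2.mfd.dim) ∞ (C.pairY a b)
    ((C.D a).U ∩ (C.D b).U) :=
  S.smooth_ζ2.comp_contMDiffOn ((C.D a).smooth_pair (C.D b))

/-- The map to `Y ×_M Y ×_M Y` given by three local sections. -/
def tripleY (a b c x : M) : G.Y3.mfd :=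
  pt3 (C.y a x) (C.y b x) (C.y c x) (C.proj_eq a b x) (C.proj_eq b c x)

/-- The intersection of three members of the cover. -/
abbrev inter (a b c : M) : Set M := (C.D a).U ∩ (C.D b).U ∩ (C.D c).U

theorem isOpen_inter (a b c : M) : IsOpen (C.inter a b c) :=
  ((C.D a).isOpen.inter (C.D b).isOpen).inter (C.D c).isOpen

theorem smooth_tripleY (a b c : M) : ContMDiffOn (𝓡 M.dim) (𝓡 G.Y3.mfd.dim) ∞ (C.tripleY a b c)
    (C.inter a b c) :=
  G.Y3.contMDiffOn (C.isOpen_inter a b c) (C.tripleY a b c)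
    ((C.smooth_y a).mono fun _ h => h.1.1) ((C.smooth_y b).mono fun _ h => h.1.2)
    ((C.smooth_y c).mono fun _ h => h.2)

/-- The unit sections of the line bundles over double intersections. -/
def σ (a b x : M) : G.L.fiber (pt2 (C.y a x) (C.y b x) (C.proj_eq a b x)) :=
  G.L.frame (C.k a b) (C.pairY a b x) default

theorem isFrameAt_k {a b x : M} (hx : x ∈ (C.D a).U ∩ (C.D b).U) :
    G.L.IsFrameAt (C.k a b) (C.pairY a b x) := G.hermitean.isFrameAt (C.mem_k a b x hx)

theorem norm_σ {a b x : M} (hx : x ∈ (C.D a).U ∩ (C.D b).U) : ‖C.σ a b x‖ = 1 :=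
  (C.isFrameAt_k hx).orthonormal.1 default

theorem inner_σ {a b x : M} (hx : x ∈ (C.D a).U ∩ (C.D b).U) :
    inner ℂ (C.σ a b x) (C.σ a b x) = (1 : ℂ) := by
  rw [inner_self_eq_norm_sq_to_K, C.norm_σ hx]
  norm_num

theorem eq_inner_smul_σ {a b x : M} (hx : x ∈ (C.D a).U ∩ (C.D b).U)
    (v : G.L.fiber (pt2 (C.y a x) (C.y b x) (C.proj_eq a b x))) :
    v = (inner ℂ (C.σ a b x) v : ℂ) • C.σ a b x := by
  have h := (C.isFrameAt_k hx).basis.sum_repr' v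
  rw [Fintype.sum_unique, BundleData.IsFrameAt.basis_apply] at h
  exact h.symm

theorem smooth_σ (a b : M) (k : G.L.ι) (i : G.L.κ k) :
    SmoothFunOn (fun x => inner ℂ (G.L.frame k (pt2 (C.y a x) (C.y b x) (C.proj_eq a b x)) i)
      (C.σ a b x)) {x | x ∈ (C.D a).U ∩ (C.D b).U ∧ C.pairY a b x ∈ G.L.U k} :=
  (G.hermitean.frame_smooth (C.k a b) k i default).comp
    ((C.smooth_pairY a b).mono fun _ h => h.1) fun x hx => ⟨C.mem_k a b x hx.1, hx.2⟩

/-- The structure functions of the product `μ` with respect to the sections `σ`. -/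
def g (a b c x : M) : ℂ :=
  inner ℂ (C.σ a c x) (G.mul (C.y a x) (C.y b x) (C.y c x) (C.proj_eq a b x) (C.proj_eq b c x)
    (C.σ a b x ⊗ₜ[ℂ] C.σ b c x))

theorem mul_σ {a b c x : M} (hx : x ∈ C.inter a b c) :
    G.mul (C.y a x) (C.y b x) (C.y c x) (C.proj_eq a b x) (C.proj_eq b c x)
      (C.σ a b x ⊗ₜ[ℂ] C.σ b c x) = C.g a b c x • C.σ a c x :=
  C.eq_inner_smul_σ ⟨hx.1.1, hx.2⟩ _

theorem norm_g {a b c x : M} (hx : x ∈ C.inter a b c) : ‖C.g a b c x‖ = 1 := by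
  have h1 : ‖G.mul (C.y a x) (C.y b x) (C.y c x) (C.proj_eq a b x) (C.proj_eq b c x)
      (C.σ a b x ⊗ₜ[ℂ] C.σ b c x)‖ = ‖C.σ a b x ⊗ₜ[ℂ] C.σ b c x‖ :=
    (G.μ (C.tripleY a b c x)).norm_map _
  rw [C.mul_σ hx, norm_smul, C.norm_σ ⟨hx.1.1, hx.2⟩, TensorProduct.norm_tmul,
    C.norm_σ hx.1, C.norm_σ ⟨hx.1.2, hx.2⟩] at h1
  simpa using h1

theorem smooth_g (a b c : M) : SmoothFunOn (C.g a b c) (C.inter a b c) :=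
  (G.μ_parallel.smooth (C.k a b, C.k b c) (C.k a c) (C.k_unique a c).default
    ((C.k_unique a b).default, (C.k_unique b c).default)).comp
    (C.smooth_tripleY a b c) fun x hx => ⟨⟨C.mem_k a b x hx.1, C.mem_k b c x ⟨hx.1.2, hx.2⟩⟩,
      C.mem_k a c x ⟨hx.1.1, hx.2⟩⟩

/-- Associativity of `μ` in terms of its structure functions. -/
theorem g_assoc {a b c d x : M} (ha : x ∈ (C.D a).U) (hb : x ∈ (C.D b).U) (hc : x ∈ (C.D c).U)
    (hd : x ∈ (C.D d).U) :
    C.g a b c x * C.g a c d x = C.g b c d x * C.g a b d x := by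
  have h := G.mul_mul (C.proj_eq a b x) (C.proj_eq b c x) (C.proj_eq c d x) (C.σ a b x)
    (C.σ b c x) (C.σ c d x)
  rw [C.mul_σ ⟨⟨ha, hb⟩, hc⟩, C.mul_σ ⟨⟨hb, hc⟩, hd⟩, ← TensorProduct.smul_tmul',
    TensorProduct.tmul_smul, map_smul, map_smul, C.mul_σ ⟨⟨ha, hc⟩, hd⟩, C.mul_σ ⟨⟨ha, hb⟩, hd⟩,
    smul_smul, smul_smul] at h
  have hne : C.σ a d x ≠ 0 := fun h0 => by
    have := C.norm_σ (a := a) (b := d) ⟨ha, hd⟩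
    simp [h0] at this
  exact smul_left_injective ℂ hne h

/-- The frames of `E` over the members of the cover. -/
def frame (a x : M) (i : Fin r) : S.E.fiber ((C.D a).s x) :=
  S.E.frame (C.D a).i ((C.D a).s x) (C.e a i)

/-- The isomorphism `α` over a double intersection. -/
def act (a b x : M) : S.E.fiber ((C.D b).s x) →ₗ[ℂ] S.E.fiber ((C.D a).s x) ⊗[ℂ]
    G.L.fiber (pt2 (C.y a x) (C.y b x) (C.proj_eq a b x)) :=
  (S.α ((C.D a).pair (C.D b) x)).toLinearEquiv.toLinearMap

theorem act_compat (a b c x : M) (v : S.E.fiber ((C.D c).s x)) :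
    LinearMap.lTensor (S.E.fiber ((C.D a).s x))
      (G.mul (C.y a x) (C.y b x) (C.y c x) (C.proj_eq a b x) (C.proj_eq b c x))
      (TensorProduct.assoc ℂ _ _ _
        (LinearMap.rTensor (G.L.fiber (pt2 (C.y b x) (C.y c x) (C.proj_eq b c x))) (C.act a b x)
          (C.act b c x v))) = C.act a c x v :=
  S.compat ((C.D a).s x) ((C.D b).s x) ((C.D c).s x) (C.proj_eq a b x) (C.proj_eq b c x) v

/-- The matrix of `α` in local frames. -/
def N (a b x : M) : Matrix (Fin r) (Fin r) ℂ := Matrix.of fun i j =>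
  inner ℂ (C.frame a x i ⊗ₜ[ℂ] C.σ a b x) (C.act a b x (C.frame b x j))

theorem isFrameAt_E {a x : M} (hx : x ∈ (C.D a).U) : S.E.IsFrameAt (C.D a).i ((C.D a).s x) :=
  S.hermitean.isFrameAt ((C.D a).mem x hx)

theorem inner_frame {a x : M} (hx : x ∈ (C.D a).U) (i j : Fin r) :
    inner ℂ (C.frame a x i) (C.frame a x j) = if i = j then (1 : ℂ) else 0 := by
  rw [frame, frame, orthonormal_iff_ite.1 (C.isFrameAt_E hx).orthonormal]
  simp

theorem act_frame {a b x : M} (hx : x ∈ (C.D a).U ∩ (C.D b).U) (j : Fin r) :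
    C.act a b x (C.frame b x j) =
      ∑ i, C.N a b x i j • (C.frame a x i ⊗ₜ[ℂ] C.σ a b x) := by
  have h := ((C.isFrameAt_E hx.1).basis.tensorProduct (C.isFrameAt_k hx).basis).sum_repr'
    (C.act a b x (C.frame b x j))
  rw [Fintype.sum_prod_type, ← (C.e a).sum_comp] at h
  refine h.symm.trans (Finset.sum_congr rfl fun i _ => ?_)
  rw [Fintype.sum_unique, OrthonormalBasis.tensorProduct_apply, BundleData.IsFrameAt.basis_apply,
    BundleData.IsFrameAt.basis_apply]
  rfl

theorem orthonormal_frame_tmul {a b x : M} (hx : x ∈ (C.D a).U ∩ (C.D b).U) :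
    Orthonormal ℂ fun i => C.frame a x i ⊗ₜ[ℂ] C.σ a b x := by
  rw [orthonormal_iff_ite]
  intro i j
  rw [TensorProduct.inner_tmul, C.inner_frame hx.1, C.inner_σ hx, mul_one]

/-- The compatibility of `α` with `μ` in local frames. -/
theorem N_mul {a b c x : M} (hx : x ∈ C.inter a b c) :
    C.N a c x = C.g a b c x • (C.N a b x * C.N b c x) := by
  have hac : x ∈ (C.D a).U ∩ (C.D c).U := ⟨hx.1.1, hx.2⟩
  have key : ∀ j, C.act a c x (C.frame c x j) =
      ∑ l, (C.g a b c x * ∑ i, C.N a b x l i * C.N b c x i j) •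
        (C.frame a x l ⊗ₜ[ℂ] C.σ a c x) := fun j => by
    rw [← C.act_compat a b c x, C.act_frame ⟨hx.1.2, hx.2⟩]
    simp only [map_sum, map_smul, LinearMap.rTensor_tmul, C.act_frame hx.1, TensorProduct.sum_tmul,
      ← TensorProduct.smul_tmul', TensorProduct.assoc_tmul, LinearMap.lTensor_tmul, C.mul_σ hx,
      TensorProduct.tmul_smul, Finset.smul_sum, Finset.mul_sum, Finset.sum_smul, smul_smul]
    rw [Finset.sum_comm]
    refine Finset.sum_congr rfl fun l _ => Finset.sum_congr rfl fun i _ => ?_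
    congr 1
    ring
  refine Matrix.ext fun l j => ?_
  have h := (C.orthonormal_frame_tmul hac).inner_right_fintype
    (fun l => C.g a b c x * ∑ i, C.N a b x l i * C.N b c x i j) l
  rw [← key] at h
  exact h

theorem det_N_ne_zero {a b x : M} (hx : x ∈ (C.D a).U ∩ (C.D b).U) : (C.N a b x).det ≠ 0 := by
  have h1 : (C.N a b x).conjTranspose * C.N a b x = 1 := by
    refine Matrix.ext fun i j => ?_
    have h := (C.orthonormal_frame_tmul hx).inner_sum (fun l => C.N a b x l i)
      (fun l => C.N a b x l j) Finset.univ
    rw [← C.act_frame hx i, ← C.act_frame hx j] at h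
    have h2 : inner ℂ (C.act a b x (C.frame b x i)) (C.act a b x (C.frame b x j)) =
        inner ℂ (C.frame b x i) (C.frame b x j) :=
      (S.α ((C.D a).pair (C.D b) x)).inner_map_map _ _
    rw [h2, C.inner_frame hx.2] at h
    rw [Matrix.one_apply, h]
    rfl
  exact (Matrix.isUnit_det_of_left_inverse h1).ne_zero

theorem continuousOn_det_N (a b : M) :
    ContinuousOn (fun x => (C.N a b x).det) ((C.D a).U ∩ (C.D b).U) := by
  have hN : ∀ i j, ContinuousOn (fun x => C.N a b x i j) ((C.D a).U ∩ (C.D b).U) := fun i j => by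
    have h := (S.α_parallel.smooth (C.D b).i ((C.D a).i, C.k a b)
      (C.e a i, (C.k_unique a b).default) (C.e b j)).continuousOn
    refine ContinuousOn.congr (h.comp ((C.D a).smooth_pair (C.D b)).continuousOn fun x hx =>
        ⟨(C.D b).mem x hx.2, (C.D a).mem x hx.1, C.mem_k a b x hx⟩) fun x hx => ?_
    rfl
  have h2 : (fun x => (C.N a b x).det) = fun x => ∑ σ : Equiv.Perm (Fin r),
      Equiv.Perm.sign σ • ∏ i, C.N a b x (σ i) i := funext fun x => Matrix.det_apply _
  rw [h2]
  exact continuousOn_finsetSum _ fun σ _ => (continuousOn_finsetProd _ fun i _ =>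
    hN _ _).const_smul _

end TrivCover

end BundleGerbe.Section

/-! ### Torsion of the Dixmier-Douady class -/

namespace BundleGerbe.Section

variable {M : Mfd.{u}} {G : BundleGerbe M} {S : G.Section} {r : ℕ}

/-- If a section has constant rank `r ≥ 1`, then `r` annihilates the Dixmier-Douady class: the
determinants of the matrices of `α` trivialise the `r`-th power of the cocycle `g`. -/
theorem TrivCover.ddTorsion (C : S.TrivCover r) (hr : 1 ≤ r) : G.DDTorsion := by
  classical
  -- a refinement over which `g` and the determinants of `N` have logarithms
  obtain ⟨τ, U, hU, hxU, hUτ, hP⟩ := exists_refinement (fun a => (C.D a).isOpen) C.cover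
    (P := fun a b c U =>
      (∃ θ : M → ℝ, SmoothFunOn θ U ∧
        ∀ x ∈ U, C.g a b c x = Complex.exp (2 * Real.pi * Complex.I * (θ x : ℂ))) ∧
      ∃ ψ : M → ℂ, ContinuousOn ψ U ∧
        ∀ x ∈ U, (C.N a b x).det = Complex.exp (2 * Real.pi * Complex.I * ψ x))
    (fun a b c U U' hUU' ⟨⟨θ, hθ, hθ'⟩, ψ, hψ, hψ'⟩ =>
      ⟨⟨θ, hθ.mono hUU', fun x hx => hθ' x (hUU' hx)⟩, ψ, hψ.mono hUU',
        fun x hx => hψ' x (hUU' hx)⟩)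
    (fun a b c x hx => by
      obtain ⟨W, hW, hxW, θ, hθ, hθ'⟩ := exists_smooth_log (C.isOpen_inter a b c) (C.smooth_g a b c)
        (fun y hy => C.norm_g hy) hx
      obtain ⟨W', hW', hxW', ψ, hψ, hψ'⟩ := exists_continuous_log
        ((C.D a).isOpen.inter (C.D b).isOpen) (C.continuousOn_det_N a b) hx.1 (C.det_N_ne_zero hx.1)
      exact ⟨W ∩ W', hW.inter hW', ⟨hxW, hxW'⟩,
        ⟨θ, hθ.mono Set.inter_subset_left, fun y hy => hθ' y hy.1⟩,
        ψ, hψ.mono Set.inter_subset_right, fun y hy => hψ' y hy.2⟩)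
  have hθ : ∀ i j k, ∃ θ : M → ℝ, SmoothFunOn θ (U i ∩ U j ∩ U k) ∧ ∀ x ∈ U i ∩ U j ∩ U k,
      C.g (τ i) (τ j) (τ k) x = Complex.exp (2 * Real.pi * Complex.I * (θ x : ℂ)) := by
    intro i j k
    by_cases h : (U i ∩ U j ∩ U k).Nonempty
    · exact (hP i j k h).1
    · rw [Set.not_nonempty_iff_eq_empty] at h
      rw [h]
      exact ⟨0, fun x hx => hx.elim, fun x hx => hx.elim⟩
  have hψ : ∀ i j, ∃ ψ : M → ℂ, ContinuousOn ψ (U i ∩ U j) ∧ ∀ x ∈ U i ∩ U j,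
      (C.N (τ i) (τ j) x).det = Complex.exp (2 * Real.pi * Complex.I * ψ x) := by
    intro i j
    by_cases h : (U i ∩ U j).Nonempty
    · have h' : U i ∩ U j ∩ U j = U i ∩ U j := by rw [Set.inter_assoc, Set.inter_self]
      have := (hP i j j (by rwa [h'])).2
      rwa [h'] at this
    · rw [Set.not_nonempty_iff_eq_empty] at h
      rw [h]
      exact ⟨0, continuousOn_empty _, fun x hx => hx.elim⟩
  choose θ hθs hθg using hθ
  choose ψ hψc hψN using hψ
  have hmem : ∀ i j k x, x ∈ U i ∩ U j ∩ U k → x ∈ C.inter (τ i) (τ j) (τ k) :=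
    fun i j k x hx => ⟨⟨hUτ i hx.1.1, hUτ j hx.1.2⟩, hUτ k hx.2⟩
  -- associativity: the coboundary of `θ` is integral
  have hint : ∀ i j k l, ∀ x ∈ U i ∩ U j ∩ U k ∩ U l, ∃ n : ℤ,
      (n : ℝ) = θ j k l x - θ i k l x + θ i j l x - θ i j k x := by
    rintro i j k l x ⟨⟨⟨hi, hj⟩, hk⟩, hl⟩
    have h := C.g_assoc (hUτ i hi) (hUτ j hj) (hUτ k hk) (hUτ l hl)
    rw [hθg i j k x ⟨⟨hi, hj⟩, hk⟩, hθg i k l x ⟨⟨hi, hk⟩, hl⟩, hθg j k l x ⟨⟨hj, hk⟩, hl⟩,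
      hθg i j l x ⟨⟨hi, hj⟩, hl⟩, ← Complex.exp_add, ← Complex.exp_add] at h
    obtain ⟨n, hn⟩ := exists_int_of_exp_eq_one
      (z := ((θ j k l x - θ i k l x + θ i j l x - θ i j k x : ℝ) : ℂ)) (by
        have h2 : 2 * Real.pi * Complex.I *
            ((θ j k l x - θ i k l x + θ i j l x - θ i j k x : ℝ) : ℂ)
          = (2 * Real.pi * Complex.I * (θ j k l x : ℂ) +
              2 * Real.pi * Complex.I * (θ i j l x : ℂ)) -
            (2 * Real.pi * Complex.I * (θ i j k x : ℂ) +
              2 * Real.pi * Complex.I * (θ i k l x : ℂ)) := by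
          push_cast
          ring
        rw [h2, Complex.exp_sub, ← h, div_self (Complex.exp_ne_zero _)])
    exact ⟨n, by exact_mod_cast hn.symm⟩
  -- the determinant of the compatibility condition
  have hdet : ∀ i j k, ∀ x ∈ U i ∩ U j ∩ U k, ∃ n : ℤ,
      (r : ℂ) * θ i j k x + ψ i j x + ψ j k x - ψ i k x = n := by
    intro i j k x hx
    have h := congrArg Matrix.det (C.N_mul (hmem i j k x hx))
    rw [Matrix.det_smul, Matrix.det_mul, Fintype.card_fin, hθg i j k x hx,
      hψN i k x ⟨hx.1.1, hx.2⟩, hψN i j x hx.1, hψN j k x ⟨hx.1.2, hx.2⟩, ← Complex.exp_nat_mul,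
      ← Complex.exp_add, ← Complex.exp_add] at h
    refine exists_int_of_exp_eq_one ?_
    have h2 : 2 * Real.pi * Complex.I * ((r : ℂ) * θ i j k x + ψ i j x + ψ j k x - ψ i k x) =
        (r * (2 * Real.pi * Complex.I * (θ i j k x : ℂ)) +
          (2 * Real.pi * Complex.I * ψ i j x + 2 * Real.pi * Complex.I * ψ j k x)) -
          2 * Real.pi * Complex.I * ψ i k x := by ring
    rw [h2, Complex.exp_sub, ← h, div_self (Complex.exp_ne_zero _)]
  -- The determinant is only known to be non-zero, so its logarithm `ψ` is complex; the real part
  -- suffices, since the right-hand side of `hdet` is an integer.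
  let β : M → M → M → M → ℝ := fun i j k x =>
    r * θ i j k x + ((ψ i j x).re + (ψ j k x).re - (ψ i k x).re)
  -- rounding makes the integer values into functions defined everywhere
  let b : M → M → M → M → ℤ := fun i j k x => round (β i j k x)
  have hb : ∀ i j k, ∀ x ∈ U i ∩ U j ∩ U k, (b i j k x : ℝ) = β i j k x := by
    intro i j k x hx
    obtain ⟨n, hn⟩ := hdet i j k x hx
    have h2 : β i j k x = n := by
      have := congrArg Complex.re hn
      simp only [Complex.add_re, Complex.sub_re, Complex.intCast_re] at this
      rw [← this, ← Complex.ofReal_natCast, ← Complex.ofReal_mul, Complex.ofReal_re]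
      simp only [β]
      ring
    simp only [b, h2, round_intCast]
  let c : M → M → M → M → M → ℤ := fun i j k l x =>
    round (θ j k l x - θ i k l x + θ i j l x - θ i j k x)
  have hc : ∀ i j k l, ∀ x ∈ U i ∩ U j ∩ U k ∩ U l,
      (c i j k l x : ℝ) = θ j k l x - θ i k l x + θ i j l x - θ i j k x := by
    intro i j k l x hx
    obtain ⟨n, hn⟩ := hint i j k l x hx
    simp only [c, ← hn, round_intCast]
  refine ⟨r, hr, {
    ι := M
    U := U
    isOpen := hU
    cover := fun x => ⟨x, hxU x⟩
    s := fun i => C.y (τ i)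
    proj_s := fun i => C.proj_y (τ i)
    s_smooth := fun i => (C.smooth_y (τ i)).mono (hUτ i)
    σ := fun i j => C.σ (τ i) (τ j)
    σ_unit := fun i j x hx => C.norm_σ ⟨hUτ i hx.1, hUτ j hx.2⟩
    σ_smooth := fun i j k a => (C.smooth_σ (τ i) (τ j) k a).mono fun x hx =>
      ⟨⟨hUτ i hx.1.1, hUτ j hx.1.2⟩, hx.2⟩
    θ := θ
    θ_smooth := hθs
    mul_σ := fun i j k x hx => by
      rw [← hθg i j k x hx]
      exact C.mul_σ (hmem i j k x hx)
    c := c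
    c_eq := hc }, b, ?_, ?_⟩
  · intro i j k
    refine Int.isClosedEmbedding_coe_real.isInducing.continuousOn_iff.2 ?_
    refine ContinuousOn.congr (f := β i j k) ?_ (hb i j k)
    have h1 := (hψc i j).mono (Set.inter_subset_left (t := U k))
    have h2 := (hψc j k).mono (fun x (hx : x ∈ U i ∩ U j ∩ U k) => ⟨hx.1.2, hx.2⟩)
    have h3 := (hψc i k).mono (fun x (hx : x ∈ U i ∩ U j ∩ U k) => ⟨hx.1.1, hx.2⟩)
    exact (continuousOn_const.mul (hθs i j k).continuousOn).add
      (((Complex.continuous_re.comp_continuousOn h1).add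
        (Complex.continuous_re.comp_continuousOn h2)).sub
        (Complex.continuous_re.comp_continuousOn h3))
  · rintro i j k l x ⟨⟨⟨hi, hj⟩, hk⟩, hl⟩
    have h1 := hb j k l x ⟨⟨hj, hk⟩, hl⟩
    have h2 := hb i k l x ⟨⟨hi, hk⟩, hl⟩
    have h3 := hb i j l x ⟨⟨hi, hj⟩, hl⟩
    have h4 := hb i j k x ⟨⟨hi, hj⟩, hk⟩
    have h5 := hc i j k l x ⟨⟨⟨hi, hj⟩, hk⟩, hl⟩
    have : ((r : ℤ) : ℝ) * (c i j k l x : ℝ) =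
        b j k l x - b i k l x + b i j l x - b i j k x := by
      rw [h1, h2, h3, h4, h5]
      simp only [β, Int.cast_natCast]
      ring
    exact_mod_cast this

/-- A non-zero section over a connected base has constant positive rank. -/
theorem ddTorsion [ConnectedSpace M] (S : G.Section) (hS : ¬ S.IsZero) : G.DDTorsion := by
  obtain ⟨z, hz⟩ := not_forall.1 hS
  rw [subsingleton_fiber_iff] at hz
  obtain ⟨C⟩ := S.exists_trivCover (r := S.rank (G.proj (S.ζ z))) fun x =>
    S.isLocallyConstant_rank.apply_eq_of_preconnectedSpace _ _
  exact C.ddTorsion (Nat.one_le_iff_ne_zero.2 hz)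

end BundleGerbe.Section

end
end Gerbe

theorem mainTheorem2 (M : Gerbe.Mfd.{u}) (G : Gerbe.BundleGerbe M)
    (H : Gerbe.DForm M 3 Gerbe.ImR) (hH : G.IsCurvature H) :
    (∃ hc : H ∈ Gerbe.closedForms M 3 Gerbe.ImR,
      Gerbe.deRhamClass ⟨H, hc⟩ ≠ 0 →
        (∀ S : G.Section, ∃ x : M, S.VanishesOver (connectedComponent x)) ∧
        (ConnectedSpace M → ¬ ∃ S : G.Section, ¬ S.IsZero)) ∧
    (ConnectedSpace M → (∃ S : G.Section, ¬ S.IsZero) → G.DDTorsion) := by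
  refine ⟨⟨hH.mem_closedForms, fun hne => ⟨fun S => S.exists_vanishesOver hH hne, ?_⟩⟩, ?_⟩
  · rintro hM ⟨S, hS⟩
    obtain ⟨x, hx⟩ := S.exists_vanishesOver hH hne
    exact hS fun z => hx z (by rw [PreconnectedSpace.connectedComponent_eq_univ]; trivial)
  · rintro hM ⟨S, hS⟩
    exact S.ddTorsion hS
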